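/- Let $s>0$ and let $\rho_0,u_0,v_0\in L^\infty(\mathbb R)$ with $\rho_0\ge\underline\rho$ a.e. for a constant $\underline\rho>0$. Assume: H1: there are constants $c_1,\dots,c_5$ with $c_5-\frac{c_4-c_1}{2s}>0$ such that a.e. $c_1\le u_0-sv_0\le c_2$, $c_3\le u_0+sv_0\le c_4$ and $v_0+\frac1{\rho_0}>c_5$; H2: $u_0-sv_0$ and $u_0+sv_0$ have bounded total variation on $\mathbb R$ (that is, each agrees a.e. with a function of bounded variation); and $\operatorname{ess\,inf}_{x}\big(u_0(x)+\tfrac{s}{\rho_0(x)}\big)>\operatorname{ess\,sup}_{x}\big(u_0(x)-\tfrac{s}{\rho_0(x)}\big)$. Consider the Cauchy problem, for $t>0$, $x\in\mathbb R$, of the simplified Bouchut–Boyaval system $$\rho_t+(\rho u)_x=0,\qquad (\rho u)_t+(\rho u^2+s^2v)_x=0,\qquad (\rho v)_t+(\rho uv+u)_x=0,$$ with $(\rho,u,v)(0,\cdot)=(\rho_0,u_0,v_0)$. For functions $F,G,H:\mathbb R\to\mathbb R$ put $$\eta=\rho\big(F(u+sv)+G(u-sv)+H(v+\tfrac1\rho)\big),\quad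 q=(\rho u+s)F(u+sv)+(\rho u-s)G(u-sv)+\rho u\,H(v+\tfrac1\rho).$$ An entropy solution is a triple $(\rho,u,v)\in L^\infty((0,\infty)\times\mathbb R)^3$ with $\rho>0$ a.e. which solves the Cauchy problem weakly (against $C_c^\infty(\mathbb R^2)$ test functions, the initial values entering through the integral over $t=0$) and such that, for all convex $F,G,H$, the functions $\eta,q$ are locally integrable and $\eta_t+q_x=0$ in the sense of distributions on $(0,\infty)\times\mathbb R$. Put $Y_0(x)=\int_0^x\rho_0(\xi)\,d\xi$, $X_0=Y_0^{-1}$, and for $t\ge0$, $y\in\mathbb R$, $$X(t,y)=\frac1{2s}\int_{y-st}^{y+st}u_0(X_0(\xi))\,d\xi+\int_0^y\Big(v_0(X_0(\xi))+\frac1{\rho_0(X_0(\xi))}\Big)d\xi-\frac12\int_0^{y+st}v_0(X_0(\xi))\,d\xi-\frac12\int_0^{y-st}v_0(X_0(\xi))\,d\xi .$$ Then $Y_0$ is a bijection of $\mathbb R$, $X(t,\cdot)$ is a bijection of $\mathbb R$ for every $t\ge 0$, and, with $Y(t,\cdot)=X(t,\cdot)^{-1}$, $$\Gamma^\pm(t,x)=\tfrac12\big[u_0(X_0(Y(t,x)+st))\pm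 u_0(X_0(Y(t,x)-st))\big],\quad \Upsilon^\pm(t,x)=\tfrac12\big[v_0(X_0(Y(t,x)+st))\pm v_0(X_0(Y(t,x)-st))\big],$$ the Cauchy problem has a unique (up to null sets) entropy solution, given by $$u=\Gamma^+-s\Upsilon^-,\qquad v=\Upsilon^+-\tfrac1s\Gamma^-,\qquad \rho(t,x)=\frac{\rho_0(X_0(Y(t,x)))}{1+\rho_0(X_0(Y(t,x)))\,[\,v_0(X_0(Y(t,x)))-v(t,x)\,]} .$$ It satisfies $\eta_t+q_x=0$ in the sense of distributions for all Borel functions $F,G,H$ that are bounded on bounded sets, convex or not. Moreover, $Y$ is Lipschitz on $[0,\infty)\times\mathbb R$ with $Y(0,\cdot)=Y_0$ and $dY=\rho\,dx-\rho u\,dt$ a.e. (the Euler–Lagrange transformation), and in the coordinates $(t,y)$ the functions $\omega(t,y)=1/\rho(t,X(t,y))$, $\nu(t,y)=u(t,X(t,y))$, $\kappa(t,y)=v(t,X(t,y))$ form a bounded weak solution of the linear system $$\omega_t-\nu_y=0,\qquad \nu_t+s^2\kappa_y=0,\qquad \kappa_t+\nu_y=0$$ with initial values $\omega_0=1/(\rho_0\circ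 X_0)$, $\nu_0=u_0\circ X_0$, $\kappa_0=v_0\circ X_0$, and for every $t\ge0$ and a.e. $y$ $$\omega(t,y)=\omega_0(y)+\kappa_0(y)-\kappa(t,y),$$ $$\nu(t,y)=\tfrac12\big(\nu_0(y+st)+\nu_0(y-st)\big)-\tfrac s2\big(\kappa_0(y+st)-\kappa_0(y-st)\big),$$ $$\kappa(t,y)=\tfrac12\big(\kappa_0(y+st)+\kappa_0(y-st)\big)-\tfrac1{2s}\big(\nu_0(y+st)-\nu_0(y-st)\big).$$ -/

import Mathlib

open MeasureTheory Set
open scoped ContDiff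

noncomputable section

namespace BouchutBoyaval

/-! Conservation laws on the open half plane `t > 0`, points being `p = (t, x)`. -/

/-- The open half plane `(0, ∞) × ℝ`. -/
def halfPlane : Set (ℝ × ℝ) := Ioi (0 : ℝ) ×ˢ (univ : Set ℝ)

/-- Lebesgue measure on the half plane. -/
def halfPlaneMeasure : Measure (ℝ × ℝ) := volume.restrict halfPlane

/-- Real test functions on the plane: smooth with compact support. -/
structure IsTestFunction (φ : ℝ × ℝ → ℝ) : Prop where
  smooth : ContDiff ℝ ∞ φ
  compactSupport : HasCompactSupport φ

/-- The partial derivative in the first variable (time). -/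
def timeDeriv (φ : ℝ × ℝ → ℝ) (p : ℝ × ℝ) : ℝ := fderiv ℝ φ p (1, 0)

/-- The partial derivative in the second variable (space). -/
def spaceDeriv (φ : ℝ × ℝ → ℝ) (p : ℝ × ℝ) : ℝ := fderiv ℝ φ p (0, 1)

/-- Weak form of the Cauchy problem `w_t + f_x = 0`, `w(0, x) = w₀ x`: the test functions need not
vanish at `t = 0`. -/
def IsWeakCauchySolution (w f : ℝ → ℝ → ℝ) (w₀ : ℝ → ℝ) : Prop :=
  ∀ φ : ℝ × ℝ → ℝ, IsTestFunction φ →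
    (∫ p, (w p.1 p.2 * timeDeriv φ p + f p.1 p.2 * spaceDeriv φ p) ∂halfPlaneMeasure)
      + ∫ x, w₀ x * φ (0, x) = 0

/-- `w_t + f_x = 0` in the sense of distributions on the open half plane, with `w` and `f` locally
integrable there. -/
def IsDistributionalSolution (w f : ℝ → ℝ → ℝ) : Prop :=
  LocallyIntegrableOn (fun p : ℝ × ℝ => w p.1 p.2) halfPlane ∧
  LocallyIntegrableOn (fun p : ℝ × ℝ => f p.1 p.2) halfPlane ∧
  ∀ φ : ℝ × ℝ → ℝ, IsTestFunction φ → tsupport φ ⊆ halfPlane →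
    ∫ p, (w p.1 p.2 * timeDeriv φ p + f p.1 p.2 * spaceDeriv φ p) ∂halfPlaneMeasure = 0

/-! The entropies, and the entropy solutions of the Cauchy problem. -/

/-- The entropy `ρ (F (u + s v) + G (u - s v) + H (v + 1 / ρ))`. -/
def entropy (s : ℝ) (F G H : ℝ → ℝ) (ρ u v : ℝ) : ℝ :=
  ρ * (F (u + s * v) + G (u - s * v) + H (v + 1 / ρ))

/-- The flux of the entropy above. -/
def entropyFlux (s : ℝ) (F G H : ℝ → ℝ) (ρ u v : ℝ) : ℝ :=
  (ρ * u + s) * F (u + s * v) + (ρ * u - s) * G (u - s * v) + ρ * u * H (v + 1 / ρ)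

/-- The entropy condition `η_t + q_x = 0` for the pair given by `F`, `G`, `H`. -/
def EntropyCondition (s : ℝ) (F G H : ℝ → ℝ) (ρ u v : ℝ → ℝ → ℝ) : Prop :=
  IsDistributionalSolution
    (fun t x => entropy s F G H (ρ t x) (u t x) (v t x))
    (fun t x => entropyFlux s F G H (ρ t x) (u t x) (v t x))

/-- Global bounded entropy solutions, without vacuum, of the Cauchy problem
`ρ_t + (ρ u)_x = 0`, `(ρ u)_t + (ρ u² + s² v)_x = 0`, `(ρ v)_t + (ρ u v + u)_x = 0`
with initial data `(ρ₀, u₀, v₀)`. -/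
structure IsEntropySolution (s : ℝ) (ρ₀ u₀ v₀ : ℝ → ℝ) (ρ u v : ℝ → ℝ → ℝ) : Prop where
  rho_memLp : MemLp (fun p : ℝ × ℝ => ρ p.1 p.2) ⊤ halfPlaneMeasure
  u_memLp : MemLp (fun p : ℝ × ℝ => u p.1 p.2) ⊤ halfPlaneMeasure
  v_memLp : MemLp (fun p : ℝ × ℝ => v p.1 p.2) ⊤ halfPlaneMeasure
  rho_pos : ∀ᵐ p ∂halfPlaneMeasure, 0 < ρ p.1 p.2
  mass : IsWeakCauchySolution ρ (fun t x => ρ t x * u t x) ρ₀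
  momentum : IsWeakCauchySolution (fun t x => ρ t x * u t x)
    (fun t x => ρ t x * u t x ^ 2 + s ^ 2 * v t x) (fun x => ρ₀ x * u₀ x)
  stress : IsWeakCauchySolution (fun t x => ρ t x * v t x)
    (fun t x => ρ t x * u t x * v t x + u t x) (fun x => ρ₀ x * v₀ x)
  entropy_condition : ∀ F G H : ℝ → ℝ, ConvexOn ℝ univ F → ConvexOn ℝ univ G →
    ConvexOn ℝ univ H → EntropyCondition s F G H ρ u v

/-! The hypotheses on the initial data. -/

/-- Hypothesis H1. -/
def HypH1 (s : ℝ) (ρ₀ u₀ v₀ : ℝ → ℝ) : Prop :=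
  ∃ c₁ c₂ c₃ c₄ c₅ : ℝ,
    (∀ᵐ x, c₁ ≤ u₀ x - s * v₀ x ∧ u₀ x - s * v₀ x ≤ c₂) ∧
    (∀ᵐ x, c₃ ≤ u₀ x + s * v₀ x ∧ u₀ x + s * v₀ x ≤ c₄) ∧
    (∀ᵐ x, v₀ x + 1 / ρ₀ x > c₅) ∧
    c₅ - (c₄ - c₁) / (2 * s) > 0

/-- Bounded total variation of a function given up to null sets. -/
def HasBoundedEssVariation (f : ℝ → ℝ) : Prop :=
  ∃ g : ℝ → ℝ, g =ᵐ[volume] f ∧ BoundedVariationOn g univ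

/-- Hypothesis H2. -/
def HypH2 (s : ℝ) (u₀ v₀ : ℝ → ℝ) : Prop :=
  HasBoundedEssVariation (fun x => u₀ x - s * v₀ x) ∧
  HasBoundedEssVariation (fun x => u₀ x + s * v₀ x)

/-! The Euler--Lagrange change of variables. -/

/-- `Y₀(x) = ∫_0^x ρ₀`. -/
def lagY₀ (ρ₀ : ℝ → ℝ) (x : ℝ) : ℝ := ∫ ξ in (0 : ℝ)..x, ρ₀ ξ

/-- `X₀`, the inverse of `Y₀`. -/
def lagX₀ (ρ₀ : ℝ → ℝ) : ℝ → ℝ := Function.invFun (lagY₀ ρ₀)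

/-- The position `X(t, y)` at time `t` of the particle with Lagrangian label `y`. -/
def lagX (s : ℝ) (ρ₀ u₀ v₀ : ℝ → ℝ) (t y : ℝ) : ℝ :=
  1 / (2 * s) * (∫ ξ in (y - s * t)..(y + s * t), u₀ (lagX₀ ρ₀ ξ))
    + (∫ ξ in (0 : ℝ)..y, (v₀ (lagX₀ ρ₀ ξ) + 1 / ρ₀ (lagX₀ ρ₀ ξ)))
    - 1 / 2 * (∫ ξ in (0 : ℝ)..(y + s * t), v₀ (lagX₀ ρ₀ ξ))
    - 1 / 2 * (∫ ξ in (0 : ℝ)..(y - s * t), v₀ (lagX₀ ρ₀ ξ))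

/-- `Y(t, ·)`, the inverse of `X(t, ·)`. -/
def lagY (s : ℝ) (ρ₀ u₀ v₀ : ℝ → ℝ) (t : ℝ) : ℝ → ℝ :=
  Function.invFun (lagX s ρ₀ u₀ v₀ t)

/-- `Y` is the Euler--Lagrange map of the fields `ρ`, `u`: it is Lipschitz,
`dY = ρ dx - ρ u dt` almost everywhere for `t > 0`, and `Y(0, ·) = Y₀`. -/
structure IsEulerLagrangeMap (ρ₀ : ℝ → ℝ) (ρ u Y : ℝ → ℝ → ℝ) : Prop where
  lipschitz : ∃ K : NNReal,
    LipschitzOnWith K (fun p : ℝ × ℝ => Y p.1 p.2) (Ici (0 : ℝ) ×ˢ (univ : Set ℝ))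
  differential : ∀ᵐ p ∂halfPlaneMeasure,
    HasFDerivAt (fun q : ℝ × ℝ => Y q.1 q.2)
      (ρ p.1 p.2 • ContinuousLinearMap.snd ℝ ℝ ℝ
        - (ρ p.1 p.2 * u p.1 p.2) • ContinuousLinearMap.fst ℝ ℝ ℝ) p
  initial : ∀ x, Y 0 x = lagY₀ ρ₀ x

/-- Bounded weak solutions of the Cauchy problem for the linear system
`w_t - ν_y = 0`, `ν_t + s² κ_y = 0`, `κ_t + ν_y = 0`. -/
structure IsLagrangianSolution (s : ℝ) (w₀ ν₀ κ₀ : ℝ → ℝ) (w ν κ : ℝ → ℝ → ℝ) : Prop where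
  omega_memLp : MemLp (fun p : ℝ × ℝ => w p.1 p.2) ⊤ halfPlaneMeasure
  nu_memLp : MemLp (fun p : ℝ × ℝ => ν p.1 p.2) ⊤ halfPlaneMeasure
  kappa_memLp : MemLp (fun p : ℝ × ℝ => κ p.1 p.2) ⊤ halfPlaneMeasure
  omega_eq : IsWeakCauchySolution w (fun t y => -ν t y) w₀
  nu_eq : IsWeakCauchySolution ν (fun t y => s ^ 2 * κ t y) ν₀
  kappa_eq : IsWeakCauchySolution κ ν κ₀

/-- The d'Alembert-type formulas, for all `t ≥ 0` and almost all `y`. -/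
def IsDAlembert (s : ℝ) (w₀ ν₀ κ₀ : ℝ → ℝ) (w ν κ : ℝ → ℝ → ℝ) : Prop :=
  ∀ t : ℝ, 0 ≤ t → ∀ᵐ y : ℝ,
    w t y = w₀ y + κ₀ y - κ t y ∧
    ν t y = 1 / 2 * (ν₀ (y + s * t) + ν₀ (y - s * t))
      - s / 2 * (κ₀ (y + s * t) - κ₀ (y - s * t)) ∧
    κ t y = 1 / 2 * (κ₀ (y + s * t) + κ₀ (y - s * t))
      - 1 / (2 * s) * (ν₀ (y + s * t) - ν₀ (y - s * t))

/-! The explicit solution. -/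

/-- `u₀(X₀(Y(t, x) + a))` for `f = u₀`, and `v₀(X₀(Y(t, x) + a))` for `f = v₀`. -/
def atLabel (s : ℝ) (ρ₀ u₀ v₀ f : ℝ → ℝ) (a t x : ℝ) : ℝ :=
  f (lagX₀ ρ₀ (lagY s ρ₀ u₀ v₀ t x + a))

/-- `Γ⁺`. -/
def GammaPlus (s : ℝ) (ρ₀ u₀ v₀ : ℝ → ℝ) (t x : ℝ) : ℝ :=
  1 / 2 * (atLabel s ρ₀ u₀ v₀ u₀ (s * t) t x + atLabel s ρ₀ u₀ v₀ u₀ (-(s * t)) t x)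

/-- `Γ⁻`. -/
def GammaMinus (s : ℝ) (ρ₀ u₀ v₀ : ℝ → ℝ) (t x : ℝ) : ℝ :=
  1 / 2 * (atLabel s ρ₀ u₀ v₀ u₀ (s * t) t x - atLabel s ρ₀ u₀ v₀ u₀ (-(s * t)) t x)

/-- `Υ⁺`. -/
def UpsilonPlus (s : ℝ) (ρ₀ u₀ v₀ : ℝ → ℝ) (t x : ℝ) : ℝ :=
  1 / 2 * (atLabel s ρ₀ u₀ v₀ v₀ (s * t) t x + atLabel s ρ₀ u₀ v₀ v₀ (-(s * t)) t x)

/-- `Υ⁻`. -/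
def UpsilonMinus (s : ℝ) (ρ₀ u₀ v₀ : ℝ → ℝ) (t x : ℝ) : ℝ :=
  1 / 2 * (atLabel s ρ₀ u₀ v₀ v₀ (s * t) t x - atLabel s ρ₀ u₀ v₀ v₀ (-(s * t)) t x)

/-- The explicit velocity. -/
def uSol (s : ℝ) (ρ₀ u₀ v₀ : ℝ → ℝ) (t x : ℝ) : ℝ :=
  GammaPlus s ρ₀ u₀ v₀ t x - s * UpsilonMinus s ρ₀ u₀ v₀ t x

/-- The explicit `v`. -/
def vSol (s : ℝ) (ρ₀ u₀ v₀ : ℝ → ℝ) (t x : ℝ) : ℝ :=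
  UpsilonPlus s ρ₀ u₀ v₀ t x - 1 / s * GammaMinus s ρ₀ u₀ v₀ t x

/-- The explicit density. -/
def rhoSol (s : ℝ) (ρ₀ u₀ v₀ : ℝ → ℝ) (t x : ℝ) : ℝ :=
  ρ₀ (lagX₀ ρ₀ (lagY s ρ₀ u₀ v₀ t x)) /
    (1 + ρ₀ (lagX₀ ρ₀ (lagY s ρ₀ u₀ v₀ t x)) *
      (v₀ (lagX₀ ρ₀ (lagY s ρ₀ u₀ v₀ t x)) - vSol s ρ₀ u₀ v₀ t x))

/-- Functions bounded on bounded sets. -/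
def IsLocallyBounded (F : ℝ → ℝ) : Prop :=
  ∀ R : ℝ, ∃ C : ℝ, ∀ r : ℝ, |r| ≤ R → |F r| ≤ C

end BouchutBoyaval

end

/-!
The proof rests on potentials. A bounded weak solution of a Cauchy problem `w_t + f_x = 0`,
`w(0, ·) = w₀` is the same as a Lipschitz function `P` with `dP = w dx - f dt` almost everywhere
whose trace at `t = 0` is a primitive of `w₀` (`isWeakCauchySolution_of_potential`,
`IsWeakCauchySolution.exists_potential`). Extended by the initial value to negative times, the
field `(w, f)` becomes divergence-free in the whole plane; its flux through almost every rectangle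
vanishes by mollification, so that line integrals along the axes define `P`.

*Existence.* H1 bounds the specific volume `c(y) + (b(y + s t) - a(y - s t)) / (2 s)` from below,
where `a`, `b`, `c` are the values of `u₀ + s v₀`, `u₀ - s v₀`, `v₀ + 1 / ρ₀` in the Lagrangian
label `y`. Hence the flow `X(t, ·)`, an explicit combination of primitives of `a`, `b`, `c`, is
bi-Lipschitz, and its inverse `Y` has the differential `ρ dx - ρ u dt`
(`IsLabelData.ae_hasFDerivAt_label`). Along the solution, `u + s v = a(Y - s t)`,
`u - s v = b(Y + s t)` and `v + 1 / ρ = c(Y)`. For every bounded Borel function `f` and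
`σ ∈ {s, -s, 0}`, a primitive of `f` evaluated at `Y - σ t` is therefore a potential for the density
`ρ f(Y - σ t)` with flux `(ρ u + σ) f(Y - σ t)`. The conservation laws and the entropy equalities,
convex or not, are all sums of these (`isWeakCauchySolution_of_labels`), and the Lagrangian system
has similar potentials.

*Uniqueness.* Let `Y` be the potential of the mass equation of an arbitrary solution. Since
`Y_x = ρ > 0`, a Lipschitz function `D` with `D(0, ·) = 0` and vanishing Jacobian
`Y_x D_t - Y_t D_x` is zero: the Jacobian of `Y` and `D² χ(t) χ(Y)`, with `χ` a cutoff, has integral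
zero, and it has a sign (`eq_zero_of_jacobian_eq_zero`). Applied to `Y ∓ s t` and to the difference
between the potential of `ρ (u ± s v)` and a primitive of `a` or `b` at `Y ∓ s t`, this gives
`u + s v = a(Y - s t)` and `u - s v = b(Y + s t)` (`ae_invariant_eq`). Applied to `Y` and
`X(t, Y(t, x)) - x`, it then gives `X(t, Y(t, x)) = x`, so that `Y` is the explicit inverse flow,
and `ρ = Y_x`, `u`, `v` are determined. The composition of null sets with `Y` is harmless since
almost every slice `Y(t, ·)` is strictly increasing with positive derivative.
-/

noncomputable section

namespace BouchutBoyaval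

open Filter Topology Convolution ContinuousLinearMap
open scoped NNReal ENNReal

/-! ### Lipschitz functions of one variable -/

theorem intervalIntegrable_of_bounded {f : ℝ → ℝ} {K : ℝ} (hf : AEStronglyMeasurable f volume)
    (hK : ∀ᵐ x, |f x| ≤ K) (a b : ℝ) : IntervalIntegrable f volume a b := by
  rw [intervalIntegrable_iff]
  exact Measure.integrableOn_of_bounded (M := K) (by simp) hf (ae_restrict_of_ae hK)

theorem locallyIntegrable_of_bounded {E : Type*} [TopologicalSpace E] [MeasurableSpace E]
    {μ : Measure E} [IsLocallyFiniteMeasure μ] {f : E → ℝ} {K : ℝ}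
    (hf : AEStronglyMeasurable f μ) (hK : ∀ᵐ x ∂μ, |f x| ≤ K) : LocallyIntegrable f μ :=
  (memLp_top_of_bound hf K hK).locallyIntegrable le_top

/-- The primitive vanishing at the origin. -/
def primitive (f : ℝ → ℝ) (x : ℝ) : ℝ := ∫ ξ in (0 : ℝ)..x, f ξ

theorem primitive_sub {f : ℝ → ℝ} {K : ℝ} (hf : AEStronglyMeasurable f volume)
    (hK : ∀ᵐ x, |f x| ≤ K) (a b : ℝ) : primitive f b - primitive f a = ∫ ξ in a..b, f ξ :=
  intervalIntegral.integral_interval_sub_left (intervalIntegrable_of_bounded hf hK _ _)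
    (intervalIntegrable_of_bounded hf hK _ _)

theorem lipschitzWith_primitive {f : ℝ → ℝ} {K : ℝ} (hf : AEStronglyMeasurable f volume)
    (hK : ∀ᵐ x, |f x| ≤ K) : LipschitzWith K.toNNReal (primitive f) := by
  refine LipschitzWith.of_dist_le' fun x y => ?_
  rw [Real.dist_eq, Real.dist_eq, primitive_sub hf hK]
  exact intervalIntegral.norm_integral_le_of_norm_le_const_ae (f := f) (hK.mono fun _ h _ => h)

theorem ae_hasDerivAt_primitive {f : ℝ → ℝ} {K : ℝ} (hf : AEStronglyMeasurable f volume)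
    (hK : ∀ᵐ x, |f x| ≤ K) : ∀ᵐ x, HasDerivAt (primitive f) (f x) x :=
  (LocallyIntegrable.ae_hasDerivAt_integral (locallyIntegrable_of_bounded hf hK)).mono fun _ h => h 0

theorem _root_.LipschitzWith.sub_eq_intervalIntegral {f g : ℝ → ℝ} {K : ℝ≥0}
    (hf : LipschitzWith K f) (hg : ∀ᵐ x, HasDerivAt f (g x) x) (a b : ℝ) :
    f b - f a = ∫ x in a..b, g x := by
  rw [← (hf.lipschitzOnWith.absolutelyContinuousOnInterval).integral_deriv_eq_sub]
  exact intervalIntegral.integral_congr_ae (hg.mono fun x h _ => h.deriv)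

/-- A continuous injective function whose derivative exists and is nonzero almost everywhere pulls
null sets back to null sets: the derivative vanishes almost everywhere on the preimage of a
null set. -/
theorem ae_comp_of_hasDerivAt_ne_zero {f g : ℝ → ℝ} (hc : Continuous f)
    (hf : Function.Injective f) (hg : ∀ᵐ x, HasDerivAt f (g x) x ∧ g x ≠ 0) {q : ℝ → Prop}
    (hq : ∀ᵐ y, q y) : ∀ᵐ x, q (f x) := by
  have hN := measure_toMeasurable (μ := volume) {y | ¬ q y}
  set N := toMeasurable volume {y | ¬ q y}
  have hN0 : volume N = 0 := hN.trans hq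
  set S := f ⁻¹' N ∩ {x | DifferentiableAt ℝ f x} with hS
  have hSm : MeasurableSet S :=
    (hc.measurable (measurableSet_toMeasurable _ _)).inter (measurableSet_of_differentiableAt ℝ f)
  have key := lintegral_image_eq_lintegral_abs_deriv_mul (f := f) (f' := deriv f) hSm
    (fun x hx => hx.2.hasDerivAt.hasDerivWithinAt) hf.injOn (fun _ => 1)
  have h0 : volume (f '' S) = 0 :=
    measure_mono_null (by rintro _ ⟨x, hx, rfl⟩; exact hx.1) hN0
  simp only [lintegral_const, MeasurableSet.univ, Measure.restrict_apply, univ_inter, h0,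
    mul_zero, mul_one] at key
  have h1 := (lintegral_eq_zero_iff ((measurable_deriv f).abs.ennreal_ofReal)).1 key.symm
  have h2 : ∀ᵐ x, x ∈ S → ENNReal.ofReal |deriv f x| = 0 := (ae_restrict_iff' hSm).1 h1
  filter_upwards [h2, hg] with x hx hgx
  by_contra hqx
  have hxS : x ∈ S := ⟨subset_toMeasurable _ _ hqx, hgx.1.differentiableAt⟩
  have := hx hxS
  rw [hgx.1.deriv] at this
  simp [hgx.2] at this

/-- An expanding map of the line pulls null sets back to null sets. -/
theorem ae_comp_of_antilipschitzWith {f : ℝ → ℝ} {K : ℝ≥0} (hf : AntilipschitzWith K f)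
    {q : ℝ → Prop} (hq : ∀ᵐ y, q y) : ∀ᵐ x, q (f x) := by
  have h := hf.hausdorffMeasure_preimage_le zero_le_one {y | ¬ q y}
  rw [hausdorffMeasure_real] at h
  have h0 : volume {y | ¬ q y} = 0 := hq
  rw [h0, mul_zero] at h
  exact le_antisymm h bot_le

theorem lipschitzWith_const_mul (γ : ℝ) : LipschitzWith |γ|.toNNReal fun r : ℝ => γ * r := by
  refine LipschitzWith.of_dist_le' fun p q => ?_
  rw [Real.dist_eq, ← mul_sub, abs_mul, Real.dist_eq]

/-! ### Almost everywhere statements in the plane -/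

theorem ae_shift {q : ℝ → Prop} (hq : ∀ᵐ y, q y) (c : ℝ) : ∀ᵐ y, q (y + c) :=
  (measurePreserving_add_right volume c).quasiMeasurePreserving.ae hq

/-- Slicewise nonsingularity of a Borel function of the plane implies nonsingularity. -/
theorem ae_comp_of_ae_slice {f : ℝ × ℝ → ℝ} (hf : Measurable f) {q : ℝ → Prop} {μ : Measure ℝ}
    [SFinite μ]
    (hslice : ∀ r : ℝ → Prop, (∀ᵐ y, r y) → ∀ᵐ t ∂μ, ∀ᵐ x, r (f (t, x)))
    (hq : ∀ᵐ y, q y) : ∀ᵐ p ∂(μ.prod volume), q (f p) := by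
  have hN := measure_toMeasurable (μ := volume) {y | ¬ q y}
  set N := toMeasurable volume {y | ¬ q y}
  have hN0 : volume N = 0 := hN.trans hq
  have h1 : ∀ᵐ y, y ∉ N := measure_eq_zero_iff_ae_notMem.1 hN0
  have hm : MeasurableSet (f ⁻¹' N) := hf (measurableSet_toMeasurable _ _)
  have h2 : (μ.prod volume) (f ⁻¹' N) = 0 := by
    rw [Measure.measure_prod_null hm]
    filter_upwards [hslice _ h1] with t ht
    exact measure_eq_zero_iff_ae_notMem.2 ht
  filter_upwards [measure_eq_zero_iff_ae_notMem.1 h2] with p hp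
  by_contra h
  exact hp (subset_toMeasurable _ _ h)

theorem measurableSet_halfPlane : MeasurableSet halfPlane :=
  measurableSet_Ioi.prod MeasurableSet.univ

theorem halfPlaneMeasure_eq_prod :
    halfPlaneMeasure = (volume.restrict (Ioi (0 : ℝ))).prod (volume : Measure ℝ) := by
  rw [halfPlaneMeasure, halfPlane, Measure.volume_eq_prod, ← Measure.prod_restrict,
    Measure.restrict_univ]

theorem ae_halfPlane_iff {q : ℝ × ℝ → Prop} :
    (∀ᵐ p ∂halfPlaneMeasure, q p) ↔ ∀ᵐ p : ℝ × ℝ, 0 < p.1 → q p := by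
  rw [halfPlaneMeasure, ae_restrict_iff' measurableSet_halfPlane]
  simp [halfPlane]

theorem ae_halfPlane_of_ae {q : ℝ × ℝ → Prop} (h : ∀ᵐ p : ℝ × ℝ, q p) :
    ∀ᵐ p ∂halfPlaneMeasure, q p := ae_restrict_of_ae h

theorem ae_fst_ne (c : ℝ) : ∀ᵐ p : ℝ × ℝ, p.1 ≠ c := by
  rw [Measure.volume_eq_prod]
  exact Measure.quasiMeasurePreserving_fst.ae
    (measure_eq_zero_iff_ae_notMem.1 (Real.volume_singleton (a := c)))

/-! ### Partial derivatives of Lipschitz functions of the plane -/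

/-- The covector with time component `a` and space component `b`. -/
def covector (a b : ℝ) : ℝ × ℝ →L[ℝ] ℝ := a • fst ℝ ℝ ℝ + b • snd ℝ ℝ ℝ

@[simp] theorem covector_apply (a b : ℝ) (p : ℝ × ℝ) : covector a b p = a * p.1 + b * p.2 := by
  simp [covector]

theorem covector_eq_fderiv (f : ℝ × ℝ → ℝ) (p : ℝ × ℝ) :
    covector (timeDeriv f p) (spaceDeriv f p) = fderiv ℝ f p := by
  ext <;> simp [timeDeriv, spaceDeriv]

theorem timeDeriv_of_hasFDerivAt {f : ℝ × ℝ → ℝ} {a b : ℝ} {p : ℝ × ℝ}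
    (h : HasFDerivAt f (covector a b) p) : timeDeriv f p = a := by
  simp [timeDeriv, h.fderiv]

theorem spaceDeriv_of_hasFDerivAt {f : ℝ × ℝ → ℝ} {a b : ℝ} {p : ℝ × ℝ}
    (h : HasFDerivAt f (covector a b) p) : spaceDeriv f p = b := by
  simp [spaceDeriv, h.fderiv]

theorem hasDerivAt_time {f : ℝ × ℝ → ℝ} {a b t x : ℝ} (h : HasFDerivAt f (covector a b) (t, x)) :
    HasDerivAt (fun t => f (t, x)) a t := by
  simpa [Function.comp_def] using
    h.comp_hasDerivAt t ((hasDerivAt_id t).prodMk (hasDerivAt_const t x))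

theorem hasDerivAt_space {f : ℝ × ℝ → ℝ} {a b t x : ℝ} (h : HasFDerivAt f (covector a b) (t, x)) :
    HasDerivAt (fun x => f (t, x)) b x := by
  simpa [Function.comp_def] using
    h.comp_hasDerivAt x ((hasDerivAt_const x t).prodMk (hasDerivAt_id x))

theorem lipschitzWith_slice_space {f : ℝ × ℝ → ℝ} {K : ℝ≥0} (hf : LipschitzWith K f) (t : ℝ) :
    LipschitzWith K fun x => f (t, x) := by
  simpa [Function.comp_def] using hf.comp (LipschitzWith.prodMk_left t)

theorem lipschitzWith_slice_time {f : ℝ × ℝ → ℝ} {K : ℝ≥0} (hf : LipschitzWith K f) (x : ℝ) :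
    LipschitzWith K fun t => f (t, x) := by
  simpa [Function.comp_def] using hf.comp (LipschitzWith.prodMk_right x)

theorem _root_.LipschitzWith.ae_hasFDerivAt_covector {f : ℝ × ℝ → ℝ} {K : ℝ≥0}
    (hf : LipschitzWith K f) :
    ∀ᵐ p, HasFDerivAt f (covector (timeDeriv f p) (spaceDeriv f p)) p := by
  filter_upwards [hf.ae_differentiableAt] with p hp
  rw [covector_eq_fderiv]
  exact hp.hasFDerivAt

theorem abs_timeDeriv_le {f : ℝ × ℝ → ℝ} {K : ℝ≥0} (hf : LipschitzWith K f) (p : ℝ × ℝ) :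
    |timeDeriv f p| ≤ K := by
  refine ((fderiv ℝ f p).le_opNorm _).trans ?_
  simpa [Prod.norm_def] using norm_fderiv_le_of_lipschitz ℝ hf

theorem abs_spaceDeriv_le {f : ℝ × ℝ → ℝ} {K : ℝ≥0} (hf : LipschitzWith K f) (p : ℝ × ℝ) :
    |spaceDeriv f p| ≤ K := by
  refine ((fderiv ℝ f p).le_opNorm _).trans ?_
  simpa [Prod.norm_def] using norm_fderiv_le_of_lipschitz ℝ hf

theorem measurable_timeDeriv (f : ℝ × ℝ → ℝ) : Measurable (timeDeriv f) :=
  measurable_fderiv_apply_const ℝ f _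

theorem measurable_spaceDeriv (f : ℝ × ℝ → ℝ) : Measurable (spaceDeriv f) :=
  measurable_fderiv_apply_const ℝ f _

theorem timeDeriv_eq_zero_of_notMem_tsupport {f : ℝ × ℝ → ℝ} {p : ℝ × ℝ} (hp : p ∉ tsupport f) :
    timeDeriv f p = 0 := by
  simp [timeDeriv, fderiv_of_notMem_tsupport ℝ hp]

theorem spaceDeriv_eq_zero_of_notMem_tsupport {f : ℝ × ℝ → ℝ} {p : ℝ × ℝ} (hp : p ∉ tsupport f) :
    spaceDeriv f p = 0 := by
  simp [spaceDeriv, fderiv_of_notMem_tsupport ℝ hp]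

/-- Integration by parts for Lipschitz functions, one of them compactly supported. -/
theorem integral_fderiv_mul_eq_neg {f g : ℝ × ℝ → ℝ} {C D : ℝ≥0} (hf : LipschitzWith C f)
    (hg : LipschitzWith D g) (hc : HasCompactSupport g) (v : ℝ × ℝ) :
    ∫ p, fderiv ℝ f p v * g p = - ∫ p, f p * fderiv ℝ g p v := by
  have h := hf.integral_lineDeriv_mul_eq hg hc v (μ := volume)
  rw [← integral_neg]
  calc _ = ∫ p, lineDeriv ℝ f p v * g p := integral_congr_ae (by
        filter_upwards [hf.ae_differentiableAt] with p hp
        rw [hp.lineDeriv_eq_fderiv])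
    _ = _ := h
    _ = _ := integral_congr_ae (by
        filter_upwards [hg.ae_differentiableAt] with p hp
        simp [hp.lineDeriv_eq_fderiv, mul_comm])

/-! ### Mollification -/

/-- A sequence of smooth bumps in the plane shrinking to the origin. -/
def bump (n : ℕ) : ContDiffBump (0 : ℝ × ℝ) where
  rIn := 1 / (2 * (n + 1))
  rOut := 1 / (n + 1)
  rIn_pos := by positivity
  rIn_lt_rOut := by
    apply one_div_lt_one_div_of_lt <;> linarith [(Nat.cast_nonneg n : (0 : ℝ) ≤ n)]

theorem bump_rOut_le_one (n : ℕ) : (bump n).rOut ≤ 1 := by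
  change (1 : ℝ) / (n + 1) ≤ 1
  rw [div_le_one (by positivity)]
  linarith [(Nat.cast_nonneg n : (0 : ℝ) ≤ n)]

/-- The convolution of `g` with the normalized `n`-th bump. -/
def mollify (n : ℕ) (g : ℝ × ℝ → ℝ) : ℝ × ℝ → ℝ :=
  (bump n).normed volume ⋆[lsmul ℝ ℝ, volume] g

theorem mollify_apply (n : ℕ) (g : ℝ × ℝ → ℝ) (p : ℝ × ℝ) :
    mollify n g p = ∫ q, (bump n).normed volume q * g (p - q) := rfl

theorem ae_tendsto_mollify {g : ℝ × ℝ → ℝ} (hg : LocallyIntegrable g volume) :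
    ∀ᵐ p, Tendsto (fun n => mollify n g p) atTop (𝓝 (g p)) := by
  refine ContDiffBump.ae_convolution_tendsto_right_of_locallyIntegrable (K := 2)
    tendsto_one_div_add_atTop_nhds_zero_nat (Eventually.of_forall fun n => ?_) hg
  change (1 : ℝ) / (n + 1) ≤ 2 * (1 / (2 * (n + 1)))
  apply le_of_eq
  field_simp

theorem contDiff_mollify (n : ℕ) {g : ℝ × ℝ → ℝ} (hg : LocallyIntegrable g volume) :
    ContDiff ℝ ∞ (mollify n g) :=
  (bump n).hasCompactSupport_normed.contDiff_convolution_left _ (bump n).contDiff_normed hg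

/-- A bound for `g` on the ball of radius `1` around a point bounds the mollification there. -/
theorem abs_mollify_le (n : ℕ) {g : ℝ × ℝ → ℝ} {p : ℝ × ℝ} {C : ℝ}
    (hg : ∀ q, dist q p ≤ 1 → |g q| ≤ C) : |mollify n g p| ≤ C := by
  have h : ‖mollify n g p‖ ≤ ∫ q, (bump n).normed volume q * C := by
    refine norm_integral_le_of_norm_le ((bump n).integrable_normed.mul_const C)
      (Eventually.of_forall fun q => ?_)
    change ‖(bump n).normed volume q * g (p - q)‖ ≤ _
    rw [norm_mul, Real.norm_of_nonneg ((bump n).nonneg_normed q)]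
    by_cases hq : q ∈ Metric.ball (0 : ℝ × ℝ) (bump n).rOut
    · refine mul_le_mul_of_nonneg_left (hg _ ?_) ((bump n).nonneg_normed q)
      have : ‖q‖ < (bump n).rOut := by simpa using hq
      simpa [dist_eq_norm] using this.le.trans (bump_rOut_le_one n)
    · have : (bump n).normed volume q = 0 := by
        rw [← (bump n).support_normed_eq (μ := volume)] at hq
        simpa using hq
      simp [this]
  rwa [integral_mul_const, (bump n).integral_normed, one_mul] at h

theorem fderiv_mollify (n : ℕ) {g : ℝ × ℝ → ℝ} (hg : LocallyIntegrable g volume) (p v : ℝ × ℝ) :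
    fderiv ℝ (mollify n g) p v
      = ∫ q, fderiv ℝ ((bump n).normed volume) q v * g (p - q) := by
  have hs : ContDiff ℝ 1 ((bump n).normed (volume : Measure (ℝ × ℝ))) := (bump n).contDiff_normed
  have h := (bump n).hasCompactSupport_normed.hasFDerivAt_convolution_left (μ := volume)
    (lsmul ℝ ℝ) hs hg p
  have hi := HasCompactSupport.convolutionExists_left ((lsmul ℝ ℝ).precompL (ℝ × ℝ))
    ((bump n).hasCompactSupport_normed.fderiv ℝ) (hs.continuous_fderiv one_ne_zero) hg p
  rw [mollify, h.fderiv, convolution_def, ContinuousLinearMap.integral_apply hi]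
  rfl

/-- Differentiation commutes with the mollification of a Lipschitz function. -/
theorem fderiv_mollify_of_lipschitzWith (n : ℕ) {g : ℝ × ℝ → ℝ} {C : ℝ≥0}
    (hg : LipschitzWith C g) (p v : ℝ × ℝ) :
    fderiv ℝ (mollify n g) p v = mollify n (fun q => fderiv ℝ g q v) p := by
  rw [fderiv_mollify n hg.continuous.locallyIntegrable, mollify_apply]
  obtain ⟨D, hD⟩ := ContDiff.lipschitzWith_of_hasCompactSupport
    (bump n).hasCompactSupport_normed ((bump n).contDiff_normed (μ := volume) (n := 1)) one_ne_zero
  have hg' : LipschitzWith C fun q => g (p - q) := by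
    have h1 : LipschitzWith 1 fun q : ℝ × ℝ => p - q :=
      LipschitzWith.of_dist_le_mul fun q r => by simp [dist_eq_norm, norm_sub_rev]
    simpa [Function.comp_def] using hg.comp h1
  have h := integral_fderiv_mul_eq_neg hg' hD (bump n).hasCompactSupport_normed v
  have hd : ∀ᵐ q, DifferentiableAt ℝ g (p - q) :=
    (Measure.measurePreserving_sub_left volume p).quasiMeasurePreserving.ae hg.ae_differentiableAt
  have h2 : ∫ q, fderiv ℝ (fun q => g (p - q)) q v * (bump n).normed volume q
      = ∫ q, - ((bump n).normed volume q * fderiv ℝ g (p - q) v) := by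
    refine integral_congr_ae ?_
    filter_upwards [hd] with q hq
    have h3 : HasFDerivAt (fun q => g (p - q)) _ q :=
      hq.hasFDerivAt.comp q ((hasFDerivAt_id q).const_sub p)
    rw [h3.fderiv]
    simp [mul_comm]
  rw [h2, integral_neg, neg_inj] at h
  rw [h]
  exact integral_congr_ae (Eventually.of_forall fun q => mul_comm _ _)

/-! ### Divergence-free bounded fields in the plane -/

theorem ae_abs_le_of_memLp_top {E : Type*} [MeasurableSpace E] {μ : Measure E} {f : E → ℝ}
    (hf : MemLp f ⊤ μ) : ∃ K : ℝ, 0 ≤ K ∧ ∀ᵐ x ∂μ, |f x| ≤ K := by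
  refine ⟨(eLpNormEssSup f μ).toReal, ENNReal.toReal_nonneg, ?_⟩
  have hlt : eLpNormEssSup f μ < ⊤ := by simpa [eLpNorm_exponent_top] using hf.2
  filter_upwards [ae_le_eLpNormEssSup (f := f) (μ := μ)] with x hx
  have := ENNReal.toReal_mono hlt.ne hx
  simpa using this

/-- An essentially bounded function agrees almost everywhere with a bounded Borel function. -/
theorem exists_measurable_bounded_of_memLp_top {E : Type*} [MeasurableSpace E] {μ : Measure E}
    {f : E → ℝ} (hf : MemLp f ⊤ μ) :
    ∃ (g : E → ℝ) (K : ℝ), Measurable g ∧ (∀ x, |g x| ≤ K) ∧ f =ᵐ[μ] g := by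
  obtain ⟨K, hK0, hK⟩ := ae_abs_le_of_memLp_top hf
  refine ⟨fun x => max (-K) (min K (hf.1.mk f x)), K,
    measurable_const.max (measurable_const.min hf.1.stronglyMeasurable_mk.measurable),
    fun x => abs_le.2 ⟨le_max_left _ _, max_le (by linarith) (min_le_left _ _)⟩, ?_⟩
  filter_upwards [hK, hf.1.ae_eq_mk] with x hx hxe
  rw [← hxe, min_eq_right (abs_le.1 hx).2, max_eq_right (abs_le.1 hx).1]

theorem memLp_top_of_ae_eq {E : Type*} [MeasurableSpace E] {μ : Measure E} {f g : E → ℝ} {K : ℝ}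
    (hg : Measurable g) (hK : ∀ x, |g x| ≤ K) (hfg : f =ᵐ[μ] g) : MemLp f ⊤ μ :=
  (memLp_congr_ae hfg).2 (memLp_top_of_bound hg.aestronglyMeasurable K (Eventually.of_forall hK))

theorem memLp_top_mul {E : Type*} [MeasurableSpace E] {μ : Measure E} {f g : E → ℝ}
    (hf : MemLp f ⊤ μ) (hg : MemLp g ⊤ μ) : MemLp (fun x => f x * g x) ⊤ μ :=
  hg.mul (r := ⊤) hf

theorem integrable_memLp_top_mul {μ : Measure (ℝ × ℝ)} [IsFiniteMeasureOnCompacts μ]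
    {R g : ℝ × ℝ → ℝ} {D : ℝ} {K : Set (ℝ × ℝ)} (hR : MemLp R ⊤ μ) (hg : Measurable g)
    (hK : IsCompact K) (hD : ∀ p, |g p| ≤ D) (h0 : ∀ p, p ∉ K → g p = 0) :
    Integrable (fun p => R p * g p) μ := by
  have hg1 : Integrable g μ := by
    have h1 : IntegrableOn g K μ :=
      Measure.integrableOn_of_bounded (M := D) hK.measure_lt_top.ne hg.aestronglyMeasurable
        (Eventually.of_forall hD)
    refine (integrableOn_iff_integrable_of_support_subset fun p hp => ?_).1 h1
    by_contra h
    exact hp (h0 p h)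
  obtain ⟨L, -, hL⟩ := ae_abs_le_of_memLp_top hR
  exact hg1.bdd_mul hR.1 hL

theorem IsTestFunction.lipschitzWith {φ : ℝ × ℝ → ℝ} (h : IsTestFunction φ) :
    ∃ C, LipschitzWith C φ :=
  ContDiff.lipschitzWith_of_hasCompactSupport h.compactSupport h.smooth (by simp)

theorem integrable_mul_timeDeriv {μ : Measure (ℝ × ℝ)} [IsFiniteMeasureOnCompacts μ]
    {R φ : ℝ × ℝ → ℝ} {C : ℝ≥0} (hR : MemLp R ⊤ μ) (hφ : LipschitzWith C φ)
    (hc : HasCompactSupport φ) : Integrable (fun p => R p * timeDeriv φ p) μ :=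
  integrable_memLp_top_mul hR (measurable_timeDeriv φ) hc (abs_timeDeriv_le hφ)
    fun _ => timeDeriv_eq_zero_of_notMem_tsupport

theorem integrable_mul_spaceDeriv {μ : Measure (ℝ × ℝ)} [IsFiniteMeasureOnCompacts μ]
    {R φ : ℝ × ℝ → ℝ} {C : ℝ≥0} (hR : MemLp R ⊤ μ) (hφ : LipschitzWith C φ)
    (hc : HasCompactSupport φ) : Integrable (fun p => R p * spaceDeriv φ p) μ :=
  integrable_memLp_top_mul hR (measurable_spaceDeriv φ) hc (abs_spaceDeriv_le hφ)
    fun _ => spaceDeriv_eq_zero_of_notMem_tsupport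

/-- `R_t + M_x = 0` in the sense of distributions on the whole plane. -/
def IsDivergenceFree (R M : ℝ × ℝ → ℝ) : Prop :=
  ∀ φ : ℝ × ℝ → ℝ, IsTestFunction φ → ∫ p, (R p * timeDeriv φ p + M p * spaceDeriv φ p) = 0

theorem isTestFunction_mollify (n : ℕ) {φ : ℝ × ℝ → ℝ} {C : ℝ≥0} (hφ : LipschitzWith C φ)
    (hc : HasCompactSupport φ) : IsTestFunction (mollify n φ) :=
  ⟨contDiff_mollify n hφ.continuous.locallyIntegrable,
    HasCompactSupport.convolution _ (bump n).hasCompactSupport_normed hc⟩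

/-- Smooth test functions may be replaced by Lipschitz ones, by mollification. -/
theorem IsDivergenceFree.integral_eq_zero {R M : ℝ × ℝ → ℝ} (h : IsDivergenceFree R M)
    (hR : MemLp R ⊤ volume) (hM : MemLp M ⊤ volume) {φ : ℝ × ℝ → ℝ} {C : ℝ≥0}
    (hφ : LipschitzWith C φ) (hc : HasCompactSupport φ) :
    ∫ p, (R p * timeDeriv φ p + M p * spaceDeriv φ p) = 0 := by
  obtain ⟨L, hL0, hL⟩ := ae_abs_le_of_memLp_top hR
  obtain ⟨L', hL0', hL'⟩ := ae_abs_le_of_memLp_top hM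
  set K := Metric.cthickening 1 (tsupport φ) with hK
  have hKc : IsCompact K := IsCompact.cthickening hc
  have hbd : ∀ (n : ℕ) (v p : ℝ × ℝ), ‖v‖ ≤ 1 →
      |mollify n (fun q => fderiv ℝ φ q v) p| ≤ K.indicator (fun _ => (C : ℝ)) p := by
    intro n v p hv
    refine abs_mollify_le n fun q hq => ?_
    by_cases hqs : q ∈ tsupport φ
    · have : p ∈ K := Metric.mem_cthickening_of_dist_le p q 1 _ hqs (by rwa [dist_comm])
      rw [indicator_of_mem this]
      refine ((fderiv ℝ φ q).le_opNorm v).trans ?_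
      exact (mul_le_of_le_one_right (norm_nonneg _) hv).trans (norm_fderiv_le_of_lipschitz ℝ hφ)
    · rw [fderiv_of_notMem_tsupport ℝ hqs]
      simpa using indicator_nonneg (fun _ _ => C.coe_nonneg) p
  have hloc : ∀ v, LocallyIntegrable (fun q => fderiv ℝ φ q v) volume := fun v =>
    locallyIntegrable_of_bounded (K := C * ‖v‖)
      (measurable_fderiv_apply_const ℝ φ v).aestronglyMeasurable
      (Eventually.of_forall fun q => ((fderiv ℝ φ q).le_opNorm v).trans
        (mul_le_mul_of_nonneg_right (norm_fderiv_le_of_lipschitz ℝ hφ) (norm_nonneg _)))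
  have hlim : Tendsto (fun n => ∫ p, (R p * timeDeriv (mollify n φ) p
      + M p * spaceDeriv (mollify n φ) p)) atTop
      (𝓝 (∫ p, (R p * timeDeriv φ p + M p * spaceDeriv φ p))) := by
    refine tendsto_integral_of_dominated_convergence
      (fun p => (L + L') * K.indicator (fun _ => (C : ℝ)) p) (fun n => ?_) ?_ (fun n => ?_) ?_
    · exact (hR.1.mul (measurable_timeDeriv _).aestronglyMeasurable).add
        (hM.1.mul (measurable_spaceDeriv _).aestronglyMeasurable)
    · refine Integrable.const_mul ?_ _
      exact (integrable_indicator_iff hKc.measurableSet).2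
        (integrableOn_const hKc.measure_lt_top.ne)
    · filter_upwards [hL, hL'] with p hp hp'
      have e1 : timeDeriv (mollify n φ) p = mollify n (fun q => fderiv ℝ φ q (1, 0)) p :=
        fderiv_mollify_of_lipschitzWith n hφ p _
      have e2 : spaceDeriv (mollify n φ) p = mollify n (fun q => fderiv ℝ φ q (0, 1)) p :=
        fderiv_mollify_of_lipschitzWith n hφ p _
      rw [e1, e2, add_mul]
      refine (norm_add_le _ _).trans (add_le_add ?_ ?_)
      · rw [norm_mul]
        exact mul_le_mul hp (hbd n _ p (by simp [Prod.norm_def])) (abs_nonneg _) hL0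
      · rw [norm_mul]
        exact mul_le_mul hp' (hbd n _ p (by simp [Prod.norm_def])) (abs_nonneg _) hL0'
    · filter_upwards [ae_tendsto_mollify (hloc (1, 0)), ae_tendsto_mollify (hloc (0, 1))]
        with p h1 h2
      have e1 : ∀ n, timeDeriv (mollify n φ) p = mollify n (fun q => fderiv ℝ φ q (1, 0)) p :=
        fun n => fderiv_mollify_of_lipschitzWith n hφ p _
      have e2 : ∀ n, spaceDeriv (mollify n φ) p = mollify n (fun q => fderiv ℝ φ q (0, 1)) p :=
        fun n => fderiv_mollify_of_lipschitzWith n hφ p _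
      simp only [e1, e2]
      exact (h1.const_mul _).add (h2.const_mul _)
  refine tendsto_nhds_unique hlim ?_
  simp only [h _ (isTestFunction_mollify _ hφ hc)]
  exact tendsto_const_nhds

/-- The rotated gradient of a Lipschitz function is divergence-free, because second derivatives of
test functions commute. -/
theorem isDivergenceFree_of_lipschitzWith {P : ℝ × ℝ → ℝ} {C : ℝ≥0} (hP : LipschitzWith C P) :
    IsDivergenceFree (spaceDeriv P) (fun p => - timeDeriv P p) := by
  intro φ hφ
  have hφ' : ContDiff ℝ ∞ (fderiv ℝ φ) := hφ.smooth.fderiv_right le_rfl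
  have hsm : ∀ v, ContDiff ℝ ∞ (fun p => fderiv ℝ φ p v) := fun v => hφ'.clm_apply contDiff_const
  have hcs : ∀ v, HasCompactSupport (fun p => fderiv ℝ φ p v) := fun v =>
    hφ.compactSupport.fderiv_apply ℝ v
  have hLip : ∀ v, ∃ D, LipschitzWith D (fun p => fderiv ℝ φ p v) := fun v =>
    ContDiff.lipschitzWith_of_hasCompactSupport (hcs v) (hsm v) (by simp)
  have hsymm : ∀ p, fderiv ℝ (fun p => fderiv ℝ φ p (1, 0)) p (0, 1)
      = fderiv ℝ (fun p => fderiv ℝ φ p (0, 1)) p (1, 0) := by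
    intro p
    have hd : DifferentiableAt ℝ (fderiv ℝ φ) p := hφ'.differentiable (by simp) p
    have h2 : IsSymmSndFDerivAt ℝ φ p :=
      hφ.smooth.contDiffAt.isSymmSndFDerivAt
        (by simpa using WithTop.coe_le_coe.2 (le_top : (2 : ℕ∞) ≤ ⊤))
    rw [fderiv_clm_apply hd (by fun_prop), fderiv_clm_apply hd (by fun_prop)]
    simpa using h2 (0, 1) (1, 0)
  obtain ⟨D₁, h1⟩ := hLip (1, 0)
  obtain ⟨D₂, h2⟩ := hLip (0, 1)
  obtain ⟨D, hD⟩ := hφ.lipschitzWith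
  have hmt : MemLp (timeDeriv P) ⊤ volume :=
    memLp_top_of_bound (measurable_timeDeriv P).aestronglyMeasurable C
      (Eventually.of_forall (abs_timeDeriv_le hP))
  have hmx : MemLp (spaceDeriv P) ⊤ volume :=
    memLp_top_of_bound (measurable_spaceDeriv P).aestronglyMeasurable C
      (Eventually.of_forall (abs_spaceDeriv_le hP))
  have e1 := integral_fderiv_mul_eq_neg hP h1 (hcs _) (0, 1)
  have e2 := integral_fderiv_mul_eq_neg hP h2 (hcs _) (1, 0)
  simp only [neg_mul, ← sub_eq_add_neg]
  rw [integral_sub (integrable_mul_timeDeriv hmx hD hφ.compactSupport)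
    (integrable_mul_spaceDeriv hmt hD hφ.compactSupport)]
  simp only [hsymm] at e1
  change (∫ p, fderiv ℝ P p (0, 1) * fderiv ℝ φ p (1, 0))
    - (∫ p, fderiv ℝ P p (1, 0) * fderiv ℝ φ p (0, 1)) = 0
  rw [e1, e2]
  ring

/-- The Jacobian of two Lipschitz functions, one of them compactly supported, has integral zero. -/
theorem integral_jacobian_eq_zero {P φ : ℝ × ℝ → ℝ} {C D : ℝ≥0} (hP : LipschitzWith C P)
    (hφ : LipschitzWith D φ) (hc : HasCompactSupport φ) :
    ∫ p, (spaceDeriv P p * timeDeriv φ p - timeDeriv P p * spaceDeriv φ p) = 0 := by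
  have h := (isDivergenceFree_of_lipschitzWith hP).integral_eq_zero
    (memLp_top_of_bound (measurable_spaceDeriv P).aestronglyMeasurable C
      (Eventually.of_forall (abs_spaceDeriv_le hP)))
    (memLp_top_of_bound (measurable_timeDeriv P).neg.aestronglyMeasurable C
      (Eventually.of_forall fun p => by simpa using abs_timeDeriv_le hP p)) hφ hc
  simpa [sub_eq_add_neg] using h

/-! ### Cauchy problems on the half plane as divergence-free fields on the plane -/

/-- The function equal to `w` for `t > 0` and to the initial value `w₀` for `t ≤ 0`. -/
def extendPast (w : ℝ → ℝ → ℝ) (w₀ : ℝ → ℝ) (p : ℝ × ℝ) : ℝ :=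
  if 0 < p.1 then w p.1 p.2 else w₀ p.2

theorem extendPast_eq_indicator (w : ℝ → ℝ → ℝ) (w₀ : ℝ → ℝ) :
    extendPast w w₀ = fun p => halfPlane.indicator (fun p => w p.1 p.2) p
      + halfPlaneᶜ.indicator (fun p => w₀ p.2) p := by
  funext p
  by_cases hp : 0 < p.1 <;> simp [extendPast, halfPlane, indicator, hp]

theorem memLp_extendPast {w : ℝ → ℝ → ℝ} {w₀ : ℝ → ℝ}
    (hw : MemLp (fun p : ℝ × ℝ => w p.1 p.2) ⊤ halfPlaneMeasure) (hw₀ : MemLp w₀ ⊤ volume) :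
    MemLp (extendPast w w₀) ⊤ volume := by
  rw [extendPast_eq_indicator]
  refine MemLp.add ((memLp_indicator_iff_restrict measurableSet_halfPlane).2 hw) ?_
  refine MemLp.indicator measurableSet_halfPlane.compl ?_
  obtain ⟨K, -, hK⟩ := ae_abs_le_of_memLp_top hw₀
  have hq : Measure.QuasiMeasurePreserving (Prod.snd : ℝ × ℝ → ℝ) volume volume :=
    Measure.quasiMeasurePreserving_snd
  exact memLp_top_of_bound (hw₀.1.comp_quasiMeasurePreserving hq) K (hq.ae hK)

/-- Extending the field by the initial value, with zero flux, to negative times: the integral over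
`t ≤ 0` of the time derivative of the test function produces the initial term. -/
theorem integral_extendPast {w f : ℝ → ℝ → ℝ} {w₀ : ℝ → ℝ}
    (hw : MemLp (fun p : ℝ × ℝ => w p.1 p.2) ⊤ halfPlaneMeasure)
    (hf : MemLp (fun p : ℝ × ℝ => f p.1 p.2) ⊤ halfPlaneMeasure) (hw₀ : MemLp w₀ ⊤ volume)
    {φ : ℝ × ℝ → ℝ} (hφ : IsTestFunction φ) :
    ∫ p, (extendPast w w₀ p * timeDeriv φ p + extendPast f (fun _ => 0) p * spaceDeriv φ p)
      = (∫ p, (w p.1 p.2 * timeDeriv φ p + f p.1 p.2 * spaceDeriv φ p) ∂halfPlaneMeasure)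
        + ∫ x, w₀ x * φ (0, x) := by
  obtain ⟨C, hC⟩ := hφ.lipschitzWith
  have hW := memLp_extendPast hw hw₀
  have hF := memLp_extendPast hf (w₀ := fun _ => 0) (MemLp.zero)
  have hi1 := integrable_mul_timeDeriv hW hC hφ.compactSupport
  have hi2 := integrable_mul_spaceDeriv hF hC hφ.compactSupport
  refine (integral_add_compl measurableSet_halfPlane (hi1.add hi2)).symm.trans ?_
  congr 1
  · refine setIntegral_congr_fun measurableSet_halfPlane fun p hp => ?_
    have hp' : 0 < p.1 := hp.1
    simp [extendPast, hp']
  · have hs : halfPlaneᶜ = Iic (0 : ℝ) ×ˢ (univ : Set ℝ) := by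
      ext p; simp [halfPlane]
    have h1 : ∫ p in halfPlaneᶜ, (extendPast w w₀ p * timeDeriv φ p
        + extendPast f (fun _ => 0) p * spaceDeriv φ p)
        = ∫ p in halfPlaneᶜ, extendPast w w₀ p * timeDeriv φ p := by
      refine setIntegral_congr_fun measurableSet_halfPlane.compl fun p hp => ?_
      have hp' : ¬ 0 < p.1 := fun h => hp ⟨h, trivial⟩
      simp [extendPast, hp']
    have hi := hi1.integrableOn (s := halfPlaneᶜ)
    refine h1.trans ?_
    rw [IntegrableOn] at hi
    rw [hs, Measure.volume_eq_prod, ← Measure.prod_restrict, Measure.restrict_univ] at hi ⊢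
    rw [integral_prod_symm _ hi]
    refine integral_congr_ae (Eventually.of_forall fun x => ?_)
    have h2 : ∫ t in Iic (0 : ℝ), extendPast w w₀ (t, x) * timeDeriv φ (t, x)
        = ∫ t in Iic (0 : ℝ), w₀ x * deriv (fun t => φ (t, x)) t := by
      refine setIntegral_congr_fun measurableSet_Iic fun t ht => ?_
      have ht' : ¬ 0 < t := not_lt.2 ht
      have hd : HasFDerivAt φ (covector (timeDeriv φ (t, x)) (spaceDeriv φ (t, x))) (t, x) := by
        rw [covector_eq_fderiv]
        exact (hφ.smooth.differentiable (by simp) _).hasFDerivAt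
      simp only [extendPast, ht', if_false, (hasDerivAt_time hd).deriv]
    have hemb : Topology.IsClosedEmbedding fun t : ℝ => (t, x) :=
      Topology.IsClosedEmbedding.of_continuous_injective_isClosedMap (by fun_prop)
        (fun a b h => (Prod.ext_iff.1 h).1)
        (fun s hs => by
          have : (fun t : ℝ => (t, x)) '' s = s ×ˢ {x} := by
            ext p; simp [Prod.ext_iff]; grind
          rw [this]; exact hs.prod isClosed_singleton)
    have h3 : ∫ t in Iic (0 : ℝ), deriv (fun t => φ (t, x)) t = φ (0, x) :=
      HasCompactSupport.integral_Iic_deriv_eq (f := fun t => φ (t, x))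
        ((hφ.smooth.of_le (by simp)).comp (contDiff_id.prodMk contDiff_const))
        (hφ.compactSupport.comp_isClosedEmbedding hemb) 0
    change ∫ t in Iic (0 : ℝ), extendPast w w₀ (t, x) * timeDeriv φ (t, x) = _
    rw [h2, integral_const_mul, h3]

theorem isDivergenceFree_extendPast_iff {w f : ℝ → ℝ → ℝ} {w₀ : ℝ → ℝ}
    (hw : MemLp (fun p : ℝ × ℝ => w p.1 p.2) ⊤ halfPlaneMeasure)
    (hf : MemLp (fun p : ℝ × ℝ => f p.1 p.2) ⊤ halfPlaneMeasure) (hw₀ : MemLp w₀ ⊤ volume) :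
    IsDivergenceFree (extendPast w w₀) (extendPast f fun _ => 0)
      ↔ IsWeakCauchySolution w f w₀ :=
  forall₂_congr fun _ hφ => by rw [integral_extendPast hw hf hw₀ hφ]

/-! ### Lipschitz potentials of bounded divergence-free fields -/

theorem ae_ae_swap {q : ℝ × ℝ → Prop} (h : ∀ᵐ p : ℝ × ℝ, q p) : ∀ᵐ x : ℝ, ∀ᵐ t : ℝ, q (t, x) :=
  Measure.ae_ae_of_ae_prod
    ((Measure.measurePreserving_swap (μ := (volume : Measure ℝ))
      (ν := (volume : Measure ℝ))).quasiMeasurePreserving.ae h)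

theorem ae_ae_of_ae_plane {q : ℝ × ℝ → Prop} (h : ∀ᵐ p : ℝ × ℝ, q p) :
    ∀ᵐ t : ℝ, ∀ᵐ x : ℝ, q (t, x) :=
  Measure.ae_ae_of_ae_prod h

/-- Mollification preserves the divergence-free condition, which then holds classically. -/
theorem IsDivergenceFree.div_mollify_eq_zero {R M : ℝ × ℝ → ℝ} (h : IsDivergenceFree R M)
    (hR : MemLp R ⊤ volume) (hM : MemLp M ⊤ volume) (n : ℕ) (p : ℝ × ℝ) :
    fderiv ℝ (mollify n R) p (1, 0) + fderiv ℝ (mollify n M) p (0, 1) = 0 := by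
  have hRl : LocallyIntegrable R volume := hR.locallyIntegrable le_top
  have hMl : LocallyIntegrable M volume := hM.locallyIntegrable le_top
  rw [fderiv_mollify n hRl, fderiv_mollify n hMl]
  set η : ℝ × ℝ → ℝ := (bump n).normed volume with hη
  have hηs : ContDiff ℝ ∞ η := (bump n).contDiff_normed
  have hηc : HasCompactSupport η := (bump n).hasCompactSupport_normed
  have hφ : IsTestFunction fun q => η (p - q) :=
    ⟨hηs.comp (contDiff_const.sub contDiff_id),
      hηc.comp_homeomorph (Homeomorph.subLeft p)⟩
  obtain ⟨C, hC⟩ := hφ.lipschitzWith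
  have hd : ∀ q v, fderiv ℝ (fun q => η (p - q)) q v = - fderiv ℝ η (p - q) v := by
    intro q v
    have h3 : HasFDerivAt (fun q => η (p - q)) _ q :=
      (hηs.differentiable (by simp) (p - q)).hasFDerivAt.comp q
        ((hasFDerivAt_id q).const_sub p)
    rw [h3.fderiv]; simp
  have e := h _ hφ
  rw [integral_add (integrable_mul_timeDeriv hR hC hφ.compactSupport)
    (integrable_mul_spaceDeriv hM hC hφ.compactSupport)] at e
  simp only [timeDeriv, spaceDeriv, hd, mul_neg, integral_neg] at e
  have s1 := integral_sub_left_eq_self (fun q => fderiv ℝ η q (1, 0) * R (p - q)) volume p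
  have s2 := integral_sub_left_eq_self (fun q => fderiv ℝ η q (0, 1) * M (p - q)) volume p
  simp only [sub_sub_cancel] at s1 s2
  rw [← s1, ← s2]
  simp only [mul_comm (R _), mul_comm (M _)] at e
  linarith

/-- For almost all times and positions, the flux of a bounded divergence-free field through a
rectangle with these sides vanishes. -/
theorem IsDivergenceFree.exists_rectangle {R M : ℝ × ℝ → ℝ} (h : IsDivergenceFree R M)
    (hR : Measurable R) (hM : Measurable M) {L : ℝ} (hRL : ∀ p, |R p| ≤ L)
    (hML : ∀ p, |M p| ≤ L) :
    ∃ T X : Set ℝ, (∀ᵐ t, t ∈ T) ∧ (∀ᵐ x, x ∈ X) ∧ ∀ t₁ ∈ T, ∀ t₂ ∈ T, ∀ x₁ ∈ X, ∀ x₂ ∈ X,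
      (∫ t in t₁..t₂, M (t, x₂)) - (∫ t in t₁..t₂, M (t, x₁))
        + (∫ x in x₁..x₂, R (t₂, x)) - (∫ x in x₁..x₂, R (t₁, x)) = 0 := by
  have hRm : MemLp R ⊤ volume :=
    memLp_top_of_bound hR.aestronglyMeasurable L (Eventually.of_forall hRL)
  have hMm : MemLp M ⊤ volume :=
    memLp_top_of_bound hM.aestronglyMeasurable L (Eventually.of_forall hML)
  have hRl : LocallyIntegrable R volume := hRm.locallyIntegrable le_top
  have hMl : LocallyIntegrable M volume := hMm.locallyIntegrable le_top
  have cR : ∀ n, ContDiff ℝ ∞ (mollify n R) := fun n => contDiff_mollify n hRl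
  have cM : ∀ n, ContDiff ℝ ∞ (mollify n M) := fun n => contDiff_mollify n hMl
  refine ⟨{t | ∀ᵐ x, Tendsto (fun n => mollify n R (t, x)) atTop (𝓝 (R (t, x)))},
    {x | ∀ᵐ t, Tendsto (fun n => mollify n M (t, x)) atTop (𝓝 (M (t, x)))},
    ae_ae_of_ae_plane (ae_tendsto_mollify hRl), ae_ae_swap (ae_tendsto_mollify hMl), ?_⟩
  intro t₁ ht₁ t₂ ht₂ x₁ hx₁ x₂ hx₂
  have limR : ∀ t, (∀ᵐ x, Tendsto (fun n => mollify n R (t, x)) atTop (𝓝 (R (t, x)))) →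
      Tendsto (fun n => ∫ x in x₁..x₂, mollify n R (t, x)) atTop
        (𝓝 (∫ x in x₁..x₂, R (t, x))) := by
    intro t ht
    refine intervalIntegral.tendsto_integral_filter_of_dominated_convergence (fun _ => L)
      (Eventually.of_forall fun n => ?_)
      (Eventually.of_forall fun n => Eventually.of_forall fun x _ => ?_)
      intervalIntegrable_const (ht.mono fun x hx _ => hx)
    · exact ((cR n).continuous.comp (by fun_prop : Continuous fun x : ℝ => (t, x)))
        |>.aestronglyMeasurable
    · exact abs_mollify_le n fun q _ => hRL q
  have limM : ∀ x, (∀ᵐ t, Tendsto (fun n => mollify n M (t, x)) atTop (𝓝 (M (t, x)))) →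
      Tendsto (fun n => ∫ t in t₁..t₂, mollify n M (t, x)) atTop
        (𝓝 (∫ t in t₁..t₂, M (t, x))) := by
    intro x hx
    refine intervalIntegral.tendsto_integral_filter_of_dominated_convergence (fun _ => L)
      (Eventually.of_forall fun n => ?_)
      (Eventually.of_forall fun n => Eventually.of_forall fun t _ => ?_)
      intervalIntegrable_const (hx.mono fun x hx _ => hx)
    · exact ((cM n).continuous.comp (by fun_prop : Continuous fun t : ℝ => (t, x)))
        |>.aestronglyMeasurable
    · exact abs_mollify_le n fun q _ => hML q
  have lim := (((limM x₂ hx₂).sub (limM x₁ hx₁)).add (limR t₂ ht₂)).sub (limR t₁ ht₁)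
  refine tendsto_nhds_unique lim ((tendsto_congr fun n => ?_).2 tendsto_const_nhds)
  have hdiv := h.div_mollify_eq_zero hRm hMm n
  have key := integral2_divergence_prod_of_hasFDerivAt_off_countable (mollify n R) (mollify n M)
    (fderiv ℝ (mollify n R)) (fderiv ℝ (mollify n M)) t₁ x₁ t₂ x₂ ∅ countable_empty
    (cR n).continuous.continuousOn (cM n).continuous.continuousOn
    (fun p _ => ((cR n).differentiable (by simp) p).hasFDerivAt)
    (fun p _ => ((cM n).differentiable (by simp) p).hasFDerivAt)
    (by simp only [hdiv]; exact integrableOn_zero)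
  simp only [hdiv, intervalIntegral.integral_zero] at key
  exact key.symm

theorem eq_of_ae_eq_of_continuous {f g : ℝ → ℝ} (hf : Continuous f) (hg : Continuous g)
    (h : ∀ᵐ x, f x = g x) (x : ℝ) : f x = g x :=
  congrFun ((Continuous.ae_eq_iff_eq volume hf hg).1 h) x

/-- A bounded divergence-free field on the plane is the rotated gradient of a Lipschitz function.
On a set of full measure the potential is given by line integrals along the axes; the vanishing of
the flux through rectangles makes it Lipschitz there, and it extends. -/
theorem IsDivergenceFree.exists_potential {R M : ℝ × ℝ → ℝ} (h : IsDivergenceFree R M)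
    (hR : Measurable R) (hM : Measurable M) {L : ℝ} (hRL : ∀ p, |R p| ≤ L)
    (hML : ∀ p, |M p| ≤ L) :
    ∃ (P : ℝ × ℝ → ℝ) (K : ℝ≥0), LipschitzWith K P ∧
      ∀ᵐ p, HasFDerivAt P (covector (-M p) (R p)) p := by
  obtain ⟨T, X, hT, hX, hrect⟩ := h.exists_rectangle hR hM hRL hML
  obtain ⟨t₀, ht₀⟩ := hT.exists
  obtain ⟨x₀, hx₀⟩ := hX.exists
  have mR : ∀ t, AEStronglyMeasurable (fun x => R (t, x)) volume := fun t =>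
    (hR.comp measurable_prodMk_left).aestronglyMeasurable
  have mM : ∀ x, AEStronglyMeasurable (fun t => M (t, x)) volume := fun x =>
    (hM.comp measurable_prodMk_right).aestronglyMeasurable
  have bR : ∀ t, ∀ᵐ x, |R (t, x)| ≤ L := fun t => Eventually.of_forall fun x => hRL _
  have bM : ∀ x, ∀ᵐ t, |M (t, x)| ≤ L := fun x => Eventually.of_forall fun t => hML _
  have sR : ∀ t a b, ∫ x in a..b, R (t, x)
      = primitive (fun x => R (t, x)) b - primitive (fun x => R (t, x)) a := fun t a b =>
    (primitive_sub (mR t) (bR t) a b).symm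
  have sM : ∀ x a b, ∫ t in a..b, M (t, x)
      = primitive (fun t => M (t, x)) b - primitive (fun t => M (t, x)) a := fun x a b =>
    (primitive_sub (mM x) (bM x) a b).symm
  have aR : ∀ t a b, |∫ x in a..b, R (t, x)| ≤ L * |b - a| := fun t a b =>
    intervalIntegral.norm_integral_le_of_norm_le_const_ae (f := fun x => R (t, x))
      ((bR t).mono fun _ h _ => h)
  have aM : ∀ x a b, |∫ t in a..b, M (t, x)| ≤ L * |b - a| := fun x a b =>
    intervalIntegral.norm_integral_le_of_norm_le_const_ae (f := fun t => M (t, x))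
      ((bM x).mono fun _ h _ => h)
  have hL0 : 0 ≤ L := (abs_nonneg _).trans (hRL 0)
  set P₀ : ℝ × ℝ → ℝ := fun p => (∫ x in x₀..p.2, R (p.1, x)) - ∫ t in t₀..p.1, M (t, x₀) with hP₀
  have hLip : LipschitzOnWith (L + L).toNNReal P₀ (T ×ˢ X) := by
    refine LipschitzOnWith.of_dist_le' fun p hp q hq => ?_
    have r := hrect q.1 hq.1 p.1 hp.1 x₀ hx₀ q.2 hq.2
    have e : P₀ p - P₀ q = (∫ x in q.2..p.2, R (p.1, x)) - ∫ t in q.1..p.1, M (t, q.2) := by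
      simp only [hP₀, sR, sM] at r ⊢
      linarith
    rw [Real.dist_eq, e]
    have d1 : |p.1 - q.1| ≤ dist p q := (Real.dist_eq p.1 q.1) ▸ le_max_left _ _
    have d2 : |p.2 - q.2| ≤ dist p q := (Real.dist_eq p.2 q.2) ▸ le_max_right _ _
    calc _ ≤ |∫ x in q.2..p.2, R (p.1, x)| + |∫ t in q.1..p.1, M (t, q.2)| := abs_sub _ _
      _ ≤ L * |p.2 - q.2| + L * |p.1 - q.1| := add_le_add (aR _ _ _) (aM _ _ _)
      _ ≤ L * dist p q + L * dist p q := by gcongr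
      _ = _ := by ring
  obtain ⟨P, hP, hPeq⟩ := hLip.extend_real
  refine ⟨P, _, hP, ?_⟩
  have hspace : ∀ᵐ t, ∀ᵐ x, spaceDeriv P (t, x) = R (t, x) := by
    filter_upwards [hT, ae_ae_of_ae_plane hP.ae_hasFDerivAt_covector] with t ht hdt
    have e : ∀ x, P (t, x) = P (t, x₀) + (primitive (fun x => R (t, x)) x
        - primitive (fun x => R (t, x)) x₀) := by
      refine eq_of_ae_eq_of_continuous (lipschitzWith_slice_space hP t).continuous
        (continuous_const.add ((lipschitzWith_primitive (mR t) (bR t)).continuous.sub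
          continuous_const)) ?_
      filter_upwards [hX] with x hx
      rw [← hPeq (⟨ht, hx⟩ : (t, x) ∈ T ×ˢ X), ← hPeq (⟨ht, hx₀⟩ : (t, x₀) ∈ T ×ˢ X)]
      simp only [hP₀, sR]
      ring
    filter_upwards [hdt, ae_hasDerivAt_primitive (mR t) (bR t)] with x hx1 hx2
    have h1 := hasDerivAt_space hx1
    have h2 : HasDerivAt (fun x => P (t, x)) (R (t, x)) x := by
      rw [funext e]
      exact (hx2.sub_const _).const_add _
    exact h1.unique h2
  have htime : ∀ᵐ x, ∀ᵐ t, timeDeriv P (t, x) = - M (t, x) := by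
    filter_upwards [hX, ae_ae_swap hP.ae_hasFDerivAt_covector] with x hx hdx
    have e : ∀ t, P (t, x) = P (t₀, x) - (primitive (fun t => M (t, x)) t
        - primitive (fun t => M (t, x)) t₀) := by
      refine eq_of_ae_eq_of_continuous (lipschitzWith_slice_time hP x).continuous
        (continuous_const.sub ((lipschitzWith_primitive (mM x) (bM x)).continuous.sub
          continuous_const)) ?_
      filter_upwards [hT] with t ht
      have r := hrect t₀ ht₀ t ht x₀ hx₀ x hx
      rw [← hPeq (⟨ht, hx⟩ : (t, x) ∈ T ×ˢ X), ← hPeq (⟨ht₀, hx⟩ : (t₀, x) ∈ T ×ˢ X)]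
      simp only [hP₀, sR, sM] at r ⊢
      linarith
    filter_upwards [hdx, ae_hasDerivAt_primitive (mM x) (bM x)] with t ht1 ht2
    have h1 := hasDerivAt_time ht1
    have h2 : HasDerivAt (fun t => P (t, x)) (- M (t, x)) t := by
      rw [funext e]
      exact (ht2.sub_const _).const_sub _
    exact h1.unique h2
  have m1 : MeasurableSet {p | spaceDeriv P p = R p} :=
    measurableSet_eq_fun (measurable_spaceDeriv P) hR
  have m2 : MeasurableSet {p | timeDeriv P p = - M p} :=
    measurableSet_eq_fun (measurable_timeDeriv P) hM.neg
  have a1 : ∀ᵐ p, spaceDeriv P p = R p := (Measure.ae_prod_iff_ae_ae m1).2 hspace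
  have a2 : ∀ᵐ p, timeDeriv P p = - M p :=
    (Measure.ae_prod_iff_ae_ae m2).2 ((Measure.ae_ae_comm (p := fun t x =>
      timeDeriv P (t, x) = - M (t, x)) m2).2 htime)
  filter_upwards [a1, a2, hP.ae_hasFDerivAt_covector] with p h1 h2 h3
  rwa [h1, h2] at h3

/-! ### Potentials and the Cauchy problem -/

/-- The extension of a function on `t ≥ 0` to all times, independent of `t` for `t ≤ 0`. -/
def freezePast (P : ℝ × ℝ → ℝ) (p : ℝ × ℝ) : ℝ := P (max 0 p.1, p.2)

theorem lipschitzWith_freezePast {P : ℝ × ℝ → ℝ} {K : ℝ≥0} (hP : LipschitzWith K P) :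
    LipschitzWith K (freezePast P) := by
  have h : LipschitzWith 1 fun p : ℝ × ℝ => (max 0 p.1, p.2) := by
    simpa using (LipschitzWith.prod_fst.const_max (0 : ℝ)).prodMk LipschitzWith.prod_snd
  have h2 := hP.comp h
  rwa [mul_one] at h2

theorem freezePast_eventuallyEq {P : ℝ × ℝ → ℝ} {p : ℝ × ℝ} (hp : 0 < p.1) :
    freezePast P =ᶠ[𝓝 p] P := by
  filter_upwards [continuous_fst.continuousAt.eventually (lt_mem_nhds hp)] with q hq
  rw [freezePast, max_eq_right (le_of_lt hq)]

theorem freezePast_of_nonpos {P : ℝ × ℝ → ℝ} {p : ℝ × ℝ} (hp : p.1 ≤ 0) :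
    freezePast P p = P (0, p.2) := by
  rw [freezePast, max_eq_left hp]

theorem hasFDerivAt_freezePast_of_neg {P : ℝ × ℝ → ℝ} {p : ℝ × ℝ} {d : ℝ} (hp : p.1 < 0)
    (h : HasDerivAt (fun x => P (0, x)) d p.2) :
    HasFDerivAt (freezePast P) (covector 0 d) p := by
  have h1 : HasFDerivAt (fun q : ℝ × ℝ => P (0, q.2)) (covector 0 d) p := by
    have := h.comp_hasFDerivAt p (hasFDerivAt_snd (𝕜 := ℝ) (p := p))
    simpa [covector, Function.comp_def] using this
  refine h1.congr_of_eventuallyEq ?_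
  filter_upwards [continuous_fst.continuousAt.eventually (gt_mem_nhds hp)] with q hq
  exact freezePast_of_nonpos (le_of_lt hq)

theorem ae_snd {q : ℝ → Prop} (h : ∀ᵐ x, q x) : ∀ᵐ p : ℝ × ℝ, q p.2 := by
  rw [Measure.volume_eq_prod]
  exact Measure.quasiMeasurePreserving_snd.ae h

theorem memLp_of_potential {P : ℝ × ℝ → ℝ} {K : ℝ≥0} {w f : ℝ → ℝ → ℝ} (hP : LipschitzWith K P)
    (hd : ∀ᵐ p ∂halfPlaneMeasure, HasFDerivAt P (covector (-f p.1 p.2) (w p.1 p.2)) p) :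
    MemLp (fun p : ℝ × ℝ => w p.1 p.2) ⊤ halfPlaneMeasure ∧
      MemLp (fun p : ℝ × ℝ => f p.1 p.2) ⊤ halfPlaneMeasure :=
  ⟨memLp_top_of_ae_eq (measurable_spaceDeriv P) (abs_spaceDeriv_le hP)
      (hd.mono fun p hp => (spaceDeriv_of_hasFDerivAt hp).symm),
    memLp_top_of_ae_eq (g := fun p => - timeDeriv P p) (K := K) (measurable_timeDeriv P).neg
      (fun p => by simpa using abs_timeDeriv_le hP p)
      (hd.mono fun p hp => by simp [timeDeriv_of_hasFDerivAt hp])⟩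

/-- A Lipschitz potential with the right trace at time zero yields a weak solution of the Cauchy
problem. -/
theorem isWeakCauchySolution_of_potential {P : ℝ × ℝ → ℝ} {K : ℝ≥0} {w f : ℝ → ℝ → ℝ}
    {w₀ : ℝ → ℝ} (hP : LipschitzWith K P)
    (hd : ∀ᵐ p ∂halfPlaneMeasure, HasFDerivAt P (covector (-f p.1 p.2) (w p.1 p.2)) p)
    (h0 : ∀ᵐ x, HasDerivAt (fun x => P (0, x)) (w₀ x) x) : IsWeakCauchySolution w f w₀ := by
  obtain ⟨hw, hf⟩ := memLp_of_potential hP hd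
  have hw₀ : MemLp w₀ ⊤ volume :=
    memLp_top_of_ae_eq (g := deriv fun x => P (0, x)) (K := K) (measurable_deriv _)
      (fun x => norm_deriv_le_of_lipschitz (lipschitzWith_slice_space hP 0))
      (h0.mono fun x hx => hx.deriv.symm)
  rw [← isDivergenceFree_extendPast_iff hw hf hw₀]
  have key : ∀ᵐ p, HasFDerivAt (freezePast P)
      (covector (-extendPast f (fun _ => 0) p) (extendPast w w₀ p)) p := by
    filter_upwards [ae_halfPlane_iff.1 hd, ae_snd h0, ae_fst_ne 0] with p h1 h2 h3
    rcases lt_or_gt_of_ne h3 with h | h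
    · simpa [extendPast, h.not_gt] using hasFDerivAt_freezePast_of_neg h h2
    · simpa [extendPast, h] using (h1 h).congr_of_eventuallyEq (freezePast_eventuallyEq h)
  intro φ hφ
  refine Eq.trans (integral_congr_ae ?_)
    (isDivergenceFree_of_lipschitzWith (lipschitzWith_freezePast hP) φ hφ)
  filter_upwards [key] with p hp
  rw [timeDeriv_of_hasFDerivAt hp, spaceDeriv_of_hasFDerivAt hp, neg_neg]

/-- Conversely, a bounded weak solution of the Cauchy problem has a Lipschitz potential, whose trace
at time zero is a primitive of the initial value. -/
theorem IsWeakCauchySolution.exists_potential {w f : ℝ → ℝ → ℝ} {w₀ : ℝ → ℝ}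
    (h : IsWeakCauchySolution w f w₀)
    (hw : MemLp (fun p : ℝ × ℝ => w p.1 p.2) ⊤ halfPlaneMeasure)
    (hf : MemLp (fun p : ℝ × ℝ => f p.1 p.2) ⊤ halfPlaneMeasure) (hw₀ : MemLp w₀ ⊤ volume) :
    ∃ (P : ℝ × ℝ → ℝ) (K : ℝ≥0), LipschitzWith K P ∧
      (∀ᵐ p ∂halfPlaneMeasure, HasFDerivAt P (covector (-f p.1 p.2) (w p.1 p.2)) p) ∧
      ∀ x, P (0, x) = primitive w₀ x := by
  obtain ⟨R, K₁, hRm, hRK, hR⟩ := exists_measurable_bounded_of_memLp_top (memLp_extendPast hw hw₀)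
  obtain ⟨M, K₂, hMm, hMK, hM⟩ := exists_measurable_bounded_of_memLp_top
    (memLp_extendPast hf (w₀ := fun _ => 0) MemLp.zero)
  have hdiv : IsDivergenceFree R M := by
    intro φ hφ
    rw [← (isDivergenceFree_extendPast_iff hw hf hw₀).2 h φ hφ]
    refine integral_congr_ae ?_
    filter_upwards [hR, hM] with p h1 h2
    rw [h1, h2]
  obtain ⟨P, K, hP, hPd⟩ := hdiv.exists_potential hRm hMm (L := max K₁ K₂)
    (fun p => (hRK p).trans (le_max_left _ _)) (fun p => (hMK p).trans (le_max_right _ _))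
  have hPd' : ∀ᵐ p, HasFDerivAt P
      (covector (-extendPast f (fun _ => 0) p) (extendPast w w₀ p)) p := by
    filter_upwards [hPd, hR, hM] with p h1 h2 h3
    rwa [h2, h3]
  have htrace : ∀ x, P (0, x) - P (0, 0) = primitive w₀ x := by
    intro x
    have hae : (fun t => P (t, x) - P (t, 0)) =ᵐ[volume.restrict (Iic 0)]
        fun _ => primitive w₀ x := by
      filter_upwards [ae_restrict_of_ae (ae_ae_of_ae_plane hPd'),
        ae_restrict_mem measurableSet_Iic] with t ht ht0
      rw [(lipschitzWith_slice_space hP t).sub_eq_intervalIntegral (g := w₀) _ 0 x]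
      · rfl
      · filter_upwards [ht] with y hy
        have := hasDerivAt_space hy
        rwa [extendPast, if_neg (not_lt.2 ht0)] at this
    have hc : Continuous fun t => P (t, x) - P (t, 0) :=
      (lipschitzWith_slice_time hP x).continuous.sub (lipschitzWith_slice_time hP 0).continuous
    exact Measure.eqOn_of_ae_eq hae hc.continuousOn continuousOn_const (by simp)
      (mem_Iic.2 (le_refl (0 : ℝ)))
  refine ⟨fun p => P p - P (0, 0), K, LipschitzWith.of_dist_le_mul fun p q => by
    simpa using hP.dist_le_mul p q, ?_, htrace⟩
  refine ae_halfPlane_iff.2 ?_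
  filter_upwards [hPd'] with p h1 h2
  simpa [extendPast, h2] using h1.sub_const (P (0, 0))

/-! ### Calculus of covectors -/

section Calculus

variable {f g : ℝ × ℝ → ℝ} {F : ℝ → ℝ} {a b a' b' d : ℝ} {p : ℝ × ℝ}

theorem _root_.HasDerivAt.comp_covector (hF : HasDerivAt F d (f p))
    (hf : HasFDerivAt f (covector a b) p) :
    HasFDerivAt (fun q => F (f q)) (covector (d * a) (d * b)) p := by
  have h := hF.comp_hasFDerivAt p hf
  have e : d • covector a b = covector (d * a) (d * b) := by ext <;> simp
  rwa [e] at h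

theorem hasFDerivAt_add_covector (hf : HasFDerivAt f (covector a b) p)
    (hg : HasFDerivAt g (covector a' b') p) :
    HasFDerivAt (fun q => f q + g q) (covector (a + a') (b + b')) p := by
  have e : covector a b + covector a' b' = covector (a + a') (b + b') := by ext <;> simp
  exact e ▸ hf.add hg

theorem hasFDerivAt_sub_covector (hf : HasFDerivAt f (covector a b) p)
    (hg : HasFDerivAt g (covector a' b') p) :
    HasFDerivAt (fun q => f q - g q) (covector (a - a') (b - b')) p := by
  have e : covector a b - covector a' b' = covector (a - a') (b - b') := by ext <;> simp
  exact e ▸ hf.sub hg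

theorem hasFDerivAt_const_mul_covector (c : ℝ) (hf : HasFDerivAt f (covector a b) p) :
    HasFDerivAt (fun q => c * f q) (covector (c * a) (c * b)) p := by
  have e : c • covector a b = covector (c * a) (c * b) := by ext <;> simp
  exact e ▸ hf.const_mul c

theorem hasFDerivAt_mul_covector (hf : HasFDerivAt f (covector a b) p)
    (hg : HasFDerivAt g (covector a' b') p) :
    HasFDerivAt (fun q => f q * g q)
      (covector (f p * a' + g p * a) (f p * b' + g p * b)) p := by
  have e : f p • covector a' b' + g p • covector a b
      = covector (f p * a' + g p * a) (f p * b' + g p * b) := by ext <;> simp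
  exact e ▸ hf.mul hg

theorem hasFDerivAt_fst_covector : HasFDerivAt (fun q : ℝ × ℝ => q.1) (covector 1 0) p := by
  have e : fst ℝ ℝ ℝ = covector 1 0 := by ext <;> simp
  exact e ▸ hasFDerivAt_fst

theorem hasFDerivAt_snd_covector : HasFDerivAt (fun q : ℝ × ℝ => q.2) (covector 0 1) p := by
  have e : snd ℝ ℝ ℝ = covector 0 1 := by ext <;> simp
  exact e ▸ hasFDerivAt_snd

end Calculus

/-! ### Uniqueness for the transport equation along a potential -/

/-- A nonnegative `C¹` cutoff, positive exactly on `(-n, n)` and decreasing on `[0, n]`. -/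
def cutoff (n y : ℝ) : ℝ := max 0 (n ^ 2 - y ^ 2) ^ 2

theorem hasDerivAt_max_zero_sq (y : ℝ) : HasDerivAt (fun y : ℝ => max 0 y ^ 2) (2 * max 0 y) y := by
  rcases lt_trichotomy y 0 with h | h | h
  · have h0 : (fun y : ℝ => max 0 y ^ 2) =ᶠ[𝓝 y] fun _ => 0 := by
      filter_upwards [gt_mem_nhds h] with z hz
      rw [max_eq_left (le_of_lt hz)]; norm_num
    rw [max_eq_left h.le, mul_zero]
    exact (hasDerivAt_const y (0 : ℝ)).congr_of_eventuallyEq h0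
  · subst h
    rw [max_self, mul_zero, hasDerivAt_iff_isLittleO]
    have hb : (fun x' : ℝ => max 0 x' ^ 2 - max 0 0 ^ 2 - (x' - 0) • (0 : ℝ))
        =O[𝓝 0] fun x' : ℝ => x' ^ 2 := by
      refine Asymptotics.isBigO_of_le _ fun x => ?_
      simp only [max_self, smul_zero, sub_zero, ne_eq, OfNat.ofNat_ne_zero, not_false_eq_true,
        zero_pow, norm_pow, Real.norm_eq_abs]
      refine pow_le_pow_left₀ (abs_nonneg _) ?_ 2
      rw [abs_of_nonneg (le_max_left _ _)]
      exact max_le (abs_nonneg x) (le_abs_self x)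
    refine hb.trans_isLittleO ?_
    simpa using Asymptotics.isLittleO_pow_id (𝕜 := ℝ) one_lt_two
  · have h0 : (fun y : ℝ => max 0 y ^ 2) =ᶠ[𝓝 y] fun y => y ^ 2 := by
      filter_upwards [lt_mem_nhds h] with z hz
      rw [max_eq_right (le_of_lt hz)]
    rw [max_eq_right h.le]
    simpa using (hasDerivAt_pow 2 y).congr_of_eventuallyEq h0

theorem hasDerivAt_cutoff (n y : ℝ) :
    HasDerivAt (cutoff n) (-4 * y * max 0 (n ^ 2 - y ^ 2)) y := by
  have h := (hasDerivAt_max_zero_sq (n ^ 2 - y ^ 2)).comp y ((hasDerivAt_pow 2 y).const_sub (n ^ 2))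
  refine h.congr_deriv ?_
  push_cast; ring

theorem cutoff_nonneg (n y : ℝ) : 0 ≤ cutoff n y := sq_nonneg _

theorem cutoff_le (n y : ℝ) : |cutoff n y| ≤ (n ^ 2) ^ 2 := by
  rw [abs_of_nonneg (cutoff_nonneg n y)]
  exact pow_le_pow_left₀ (le_max_left _ _) (max_le (sq_nonneg n) (by nlinarith [sq_nonneg y])) 2

theorem abs_lt_of_cutoff_ne_zero {n y : ℝ} (hn : 0 ≤ n) (h : cutoff n y ≠ 0) : |y| < n := by
  by_contra hy
  have : n ^ 2 ≤ y ^ 2 := by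
    rw [← sq_abs y]; exact pow_le_pow_left₀ hn (not_lt.1 hy) 2
  exact h (by rw [cutoff, max_eq_left (by linarith)]; norm_num)

theorem sq_sub_sq_pos {n y : ℝ} (h : |y| < n) : 0 < n ^ 2 - y ^ 2 := by
  rw [← sq_abs y]; nlinarith [abs_nonneg y]

theorem exists_lipschitzWith_cutoff {n : ℝ} (hn : 0 ≤ n) : ∃ C, LipschitzWith C (cutoff n) := by
  refine ⟨(4 * n * n ^ 2).toNNReal, lipschitzWith_of_nnnorm_deriv_le
    (fun y => (hasDerivAt_cutoff n y).differentiableAt) fun y => ?_⟩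
  rw [← NNReal.coe_le_coe, Real.coe_toNNReal _ (by positivity), (hasDerivAt_cutoff n y).deriv]
  rw [coe_nnnorm, norm_mul, norm_mul, Real.norm_eq_abs, Real.norm_eq_abs, Real.norm_eq_abs,
    abs_of_nonneg (le_max_left 0 (n ^ 2 - y ^ 2)), show |(-4 : ℝ)| = 4 by norm_num]
  rcases le_or_gt n |y| with h | h
  · have : n ^ 2 ≤ y ^ 2 := by
      rw [← sq_abs y]; exact pow_le_pow_left₀ hn h 2
    rw [max_eq_left (by linarith), mul_zero]
    positivity
  · gcongr
    exact max_le (sq_nonneg n) (by nlinarith [sq_nonneg y])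

/-- A product of Lipschitz functions is Lipschitz when the second is bounded and the first is
bounded where the second does not vanish. -/
theorem exists_lipschitzWith_mul {E : Type*} [PseudoMetricSpace E] {f g : E → ℝ} {C D : ℝ≥0}
    {A B : ℝ} (hf : LipschitzWith C f) (hg : LipschitzWith D g) (hA : ∀ p, |g p| ≤ A)
    (hB0 : 0 ≤ B) (hB : ∀ p, g p ≠ 0 → |f p| ≤ B) :
    ∃ K, LipschitzWith K fun p => f p * g p := by
  refine ⟨(C * A + B * D).toNNReal, LipschitzWith.of_dist_le' fun p q => ?_⟩
  have h1 := hf.dist_le_mul p q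
  have h2 := hg.dist_le_mul p q
  rw [Real.dist_eq] at h1 h2 ⊢
  have hA0 : 0 ≤ A := (abs_nonneg _).trans (hA p)
  -- the estimate for the half of the difference in which `f` is evaluated at `r`
  have key : ∀ r r', (f p * g p - f q * g q = (f p - f q) * g r' + f r * (g p - g q)) →
      |f r| ≤ B → |f p * g p - f q * g q| ≤ (C * A + B * D) * dist p q := by
    intro r r' e hr
    rw [e]
    refine (abs_add_le _ _).trans ?_
    rw [abs_mul, abs_mul, add_mul]
    refine add_le_add ?_ ?_
    · calc _ ≤ (C * dist p q) * A := mul_le_mul h1 (hA _) (abs_nonneg _) (by positivity)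
        _ = _ := by ring
    · calc _ ≤ B * (D * dist p q) := mul_le_mul hr h2 (abs_nonneg _) hB0
        _ = _ := by ring
  by_cases hq : g q = 0
  · by_cases hp : g p = 0
    · rw [hp, hq]
      simp only [mul_zero, sub_self, abs_zero]
      positivity
    · exact key p q (by ring) (hB p hp)
  · exact key q p (by ring) (hB q hq)

/-- Let `Y` be Lipschitz with `Y_x > 0`, and let the Lipschitz function `D` vanish for `t ≤ 0` and
satisfy `Y_x D_t - Y_t D_x = 0`, so that `D` is constant along the level lines of `Y`. Then `D`
vanishes. The energy estimate is the vanishing integral of the Jacobian of `Y` and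
`D² χ(t) χ(Y)`, where `χ` is a cutoff. -/
theorem eq_zero_of_jacobian_eq_zero {Y D : ℝ × ℝ → ℝ} {K K' : ℝ≥0} (hY : LipschitzWith K Y)
    (hD : LipschitzWith K' D) (hD0 : ∀ p : ℝ × ℝ, p.1 ≤ 0 → D p = 0) {k : ℝ} (hk : 0 < k)
    (hYk : ∀ x, k * |x| ≤ |Y (0, x)|)
    (htr : ∀ᵐ p ∂halfPlaneMeasure, 0 < spaceDeriv Y p ∧
      spaceDeriv Y p * timeDeriv D p - timeDeriv Y p * spaceDeriv D p = 0) (p : ℝ × ℝ) :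
    D p = 0 := by
  have hdist : ∀ p : ℝ × ℝ, dist p (0, p.2) = |p.1| := by
    rintro ⟨t, x⟩; simp [Prod.dist_eq]
  have hDt : ∀ p : ℝ × ℝ, |D p| ≤ K' * |p.1| := by
    intro p
    have := hD.dist_le_mul p (0, p.2)
    rwa [hD0 (0, p.2) le_rfl, dist_zero_right, hdist] at this
  have hYt : ∀ p : ℝ × ℝ, k * |p.2| ≤ |Y p| + K * |p.1| := by
    intro p
    have h1 := hY.dist_le_mul p (0, p.2)
    rw [Real.dist_eq, hdist] at h1
    have h2 := abs_sub_abs_le_abs_sub (Y (0, p.2)) (Y p)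
    rw [abs_sub_comm] at h2
    linarith [hYk p.2]
  have main : ∀ n : ℕ, ∀ᵐ p : ℝ × ℝ, 0 < p.1 → |p.1| < n → |Y p| < n → D p = 0 := by
    intro n
    obtain ⟨C, hC⟩ := exists_lipschitzWith_cutoff (n := n) (Nat.cast_nonneg n)
    set A : ℝ := ((n : ℝ) ^ 2) ^ 2 with hA
    have hA0 : 0 ≤ A := by positivity
    set g : ℝ × ℝ → ℝ := fun p => cutoff n p.1 * cutoff n (Y p) with hg
    have hgne : ∀ p, g p ≠ 0 → |p.1| < n ∧ |Y p| < n := fun p hp =>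
      ⟨abs_lt_of_cutoff_ne_zero (Nat.cast_nonneg n) (left_ne_zero_of_mul hp),
        abs_lt_of_cutoff_ne_zero (Nat.cast_nonneg n) (right_ne_zero_of_mul hp)⟩
    have hgA : ∀ p, |g p| ≤ A * A := fun p => by
      rw [hg, abs_mul]
      exact mul_le_mul (cutoff_le _ _) (cutoff_le _ _) (abs_nonneg _) hA0
    obtain ⟨C₁, hC₁⟩ : ∃ C₁, LipschitzWith C₁ g :=
      exists_lipschitzWith_mul (hC.comp LipschitzWith.prod_fst) (hC.comp hY)
        (fun p => cutoff_le _ _) hA0 (fun p _ => cutoff_le _ _)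
    have hDn : ∀ p, g p ≠ 0 → |D p| ≤ K' * n := fun p hp =>
      (hDt p).trans (mul_le_mul_of_nonneg_left (hgne p hp).1.le K'.2)
    obtain ⟨C₂, hC₂⟩ := exists_lipschitzWith_mul hD hC₁ hgA (by positivity) hDn
    have hDg : ∀ p, |D p * g p| ≤ K' * n * (A * A) := by
      intro p
      by_cases hp : g p = 0
      · rw [hp, mul_zero, abs_zero]; positivity
      · rw [abs_mul]
        exact mul_le_mul (hDn p hp) (hgA p) (abs_nonneg _) (by positivity)
    obtain ⟨C₃, hC₃⟩ := exists_lipschitzWith_mul hD hC₂ hDg (by positivity : (0 : ℝ) ≤ K' * n)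
      (fun p hp => hDn p (right_ne_zero_of_mul hp))
    set φ : ℝ × ℝ → ℝ := fun p => D p * (D p * g p) with hφ
    have hc : HasCompactSupport φ := by
      refine HasCompactSupport.intro
        (K := Icc (-(n : ℝ)) n ×ˢ Icc (-((n + K * n) / k)) ((n + K * n) / k))
        (isCompact_Icc.prod isCompact_Icc) fun p hp => ?_
      by_contra hne
      obtain ⟨h1, h2⟩ := hgne p (right_ne_zero_of_mul (right_ne_zero_of_mul hne))
      refine hp ⟨abs_le.1 h1.le, abs_le.1 ?_⟩
      rw [le_div_iff₀ hk, mul_comm]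
      refine (hYt p).trans (add_le_add h2.le (mul_le_mul_of_nonneg_left h1.le K.2))
    have hjac := integral_jacobian_eq_zero hY hC₃ hc
    have hmx : MemLp (spaceDeriv Y) ⊤ volume :=
      memLp_top_of_bound (measurable_spaceDeriv Y).aestronglyMeasurable K
        (Eventually.of_forall (abs_spaceDeriv_le hY))
    have hmt : MemLp (timeDeriv Y) ⊤ volume :=
      memLp_top_of_bound (measurable_timeDeriv Y).aestronglyMeasurable K
        (Eventually.of_forall (abs_timeDeriv_le hY))
    have hint := (integrable_mul_timeDeriv hmx hC₃ hc).sub (integrable_mul_spaceDeriv hmt hC₃ hc)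
    -- the Jacobian with the test function only sees the derivative of the cutoff in time
    have hval : ∀ᵐ p : ℝ × ℝ,
        -(spaceDeriv Y p * timeDeriv φ p - timeDeriv Y p * spaceDeriv φ p)
          = if 0 < p.1 then
              4 * p.1 * max 0 ((n : ℝ) ^ 2 - p.1 ^ 2) * D p ^ 2 * cutoff n (Y p) * spaceDeriv Y p
            else 0 := by
      filter_upwards [hY.ae_hasFDerivAt_covector, hD.ae_hasFDerivAt_covector,
        ae_halfPlane_iff.1 htr] with p h1 h2 h3
      have hgd := hasFDerivAt_mul_covector
        ((hasDerivAt_cutoff n p.1).comp_covector (f := fun q : ℝ × ℝ => q.1)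
          hasFDerivAt_fst_covector)
        ((hasDerivAt_cutoff n (Y p)).comp_covector h1)
      have hφd := hasFDerivAt_mul_covector h2 (hasFDerivAt_mul_covector h2 hgd)
      rw [timeDeriv_of_hasFDerivAt hφd, spaceDeriv_of_hasFDerivAt hφd]
      split_ifs with hp
      · have h4 := (h3 hp).2
        linear_combination (-2 * D p * (cutoff n p.1 * cutoff n (Y p))) * h4
      · rw [hD0 p (not_lt.1 hp)]
        ring
    have hnn : 0 ≤ᵐ[volume]
        fun p => -(spaceDeriv Y p * timeDeriv φ p - timeDeriv Y p * spaceDeriv φ p) := by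
      filter_upwards [hval, ae_halfPlane_iff.1 htr] with p h1 h2
      rw [Pi.zero_apply, h1]
      split_ifs with hp
      · have := (h2 hp).1
        have := cutoff_nonneg n (Y p)
        positivity
      · exact le_rfl
    have hzero := (integral_eq_zero_iff_of_nonneg_ae hnn hint.neg).1
      (by rw [integral_neg]; simpa using hjac)
    filter_upwards [hzero, hval, ae_halfPlane_iff.1 htr] with p h1 h2 h3 hp hpn hYn
    rw [h1, if_pos hp, Pi.zero_apply] at h2
    have h4 := (h3 hp).1
    have h5 : 0 < max 0 ((n : ℝ) ^ 2 - p.1 ^ 2) := lt_max_of_lt_right (sq_sub_sq_pos hpn)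
    have h6 : 0 < cutoff n (Y p) := pow_pos (lt_max_of_lt_right (sq_sub_sq_pos hYn)) 2
    by_contra hne
    have : 0 < 4 * p.1 * max 0 ((n : ℝ) ^ 2 - p.1 ^ 2) * D p ^ 2 * cutoff n (Y p)
        * spaceDeriv Y p := by positivity
    linarith
  have hae : D =ᵐ[volume] fun _ => 0 := by
    filter_upwards [ae_all_iff.2 main] with p hp
    rcases le_or_gt p.1 0 with h | h
    · exact hD0 p h
    · obtain ⟨n, hn⟩ := exists_nat_gt (max |p.1| |Y p|)
      exact hp n h ((le_max_left _ _).trans_lt hn) ((le_max_right _ _).trans_lt hn)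
  exact congrFun ((Continuous.ae_eq_iff_eq volume hD.continuous continuous_const).1 hae) p

/-! ### The flow in Lagrangian coordinates -/

/-- The position of the particle with label `y` at time `t`, for `p = (t, y)`, in terms of the
Riemann invariants `a = u + s v`, `b = u - s v` and of `c = v + 1 / ρ` at time zero. -/
def flow (s : ℝ) (a b c : ℝ → ℝ) (p : ℝ × ℝ) : ℝ :=
  primitive c p.2 + (primitive b (p.2 + s * p.1) - primitive a (p.2 - s * p.1)) / (2 * s)

/-- Everywhere defined bounded Borel invariants for which the specific volume
`c(y) + (b(y + s t) - a(y - s t)) / (2 s)` stays above `δ > 0`. -/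
structure IsLabelData (s : ℝ) (a b c : ℝ → ℝ) (K δ : ℝ) : Prop where
  s_pos : 0 < s
  δ_pos : 0 < δ
  ma : Measurable a
  mb : Measurable b
  mc : Measurable c
  ba : ∀ y, |a y| ≤ K
  bb : ∀ y, |b y| ≤ K
  bc : ∀ y, |c y| ≤ K
  le_volume : ∀ y y' y'', δ ≤ c y + (b y' - a y'') / (2 * s)

/-- The primitive of a bounded Borel function `f` is Lipschitz, with derivative `f` almost
everywhere. -/
theorem lipschitzWith_primitive_of_bounded {f : ℝ → ℝ} {K : ℝ} (hf : Measurable f)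
    (hK : ∀ x, |f x| ≤ K) : LipschitzWith K.toNNReal (primitive f) :=
  lipschitzWith_primitive hf.aestronglyMeasurable (Eventually.of_forall hK)

theorem ae_hasDerivAt_primitive_of_bounded {f : ℝ → ℝ} {K : ℝ} (hf : Measurable f)
    (hK : ∀ x, |f x| ≤ K) : ∀ᵐ x, HasDerivAt (primitive f) (f x) x :=
  ae_hasDerivAt_primitive hf.aestronglyMeasurable (Eventually.of_forall hK)

theorem hasFDerivAt_add_mul_time {Y : ℝ × ℝ → ℝ} {α β : ℝ} {p : ℝ × ℝ}
    (hY : HasFDerivAt Y (covector α β) p) (σ : ℝ) :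
    HasFDerivAt (fun q => Y q + σ * q.1) (covector (α + σ) β) p := by
  simpa using hasFDerivAt_add_covector hY (hasFDerivAt_const_mul_covector σ
    (hasFDerivAt_fst_covector (p := p)))

theorem exists_lipschitzWith_add_mul_time {Y : ℝ × ℝ → ℝ} {C : ℝ≥0} (hY : LipschitzWith C Y)
    (σ : ℝ) : ∃ D, LipschitzWith D fun q : ℝ × ℝ => Y q + σ * q.1 :=
  ⟨_, hY.add ((lipschitzWith_const_mul σ).comp LipschitzWith.prod_fst)⟩

/-- The chain rule for the flow along a moving label. -/
theorem hasFDerivAt_flow_comp {s : ℝ} (hs : s ≠ 0) {a b c : ℝ → ℝ} {Y : ℝ × ℝ → ℝ} {α β : ℝ}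
    {p : ℝ × ℝ} (hY : HasFDerivAt Y (covector α β) p)
    (hc : HasDerivAt (primitive c) (c (Y p)) (Y p))
    (hb : HasDerivAt (primitive b) (b (Y p + s * p.1)) (Y p + s * p.1))
    (ha : HasDerivAt (primitive a) (a (Y p + -s * p.1)) (Y p + -s * p.1)) :
    HasFDerivAt (fun q => flow s a b c (q.1, Y q))
      (covector ((b (Y p + s * p.1) + a (Y p + -s * p.1)) / 2
          + (c (Y p) + (b (Y p + s * p.1) - a (Y p + -s * p.1)) / (2 * s)) * α)
        ((c (Y p) + (b (Y p + s * p.1) - a (Y p + -s * p.1)) / (2 * s)) * β)) p := by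
  have h1 := hc.comp_covector hY
  have h2 := HasDerivAt.comp_covector hb (hasFDerivAt_add_mul_time hY s)
  have h3 := HasDerivAt.comp_covector ha (hasFDerivAt_add_mul_time hY (-s))
  have h4 := hasFDerivAt_add_covector h1
    (hasFDerivAt_const_mul_covector (1 / (2 * s)) (hasFDerivAt_sub_covector h2 h3))
  convert h4 using 1
  · funext q
    simp only [flow]
    rw [neg_mul, ← sub_eq_add_neg]
    ring
  · congr 1
    · field_simp
      ring
    · ring

theorem le_abs_sub_of_le_sub {f : ℝ → ℝ} {δ : ℝ} (h : ∀ x y, x ≤ y → δ * (y - x) ≤ f y - f x)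
    (x y : ℝ) : δ * |y - x| ≤ |f y - f x| := by
  rcases le_total x y with hy | hy
  · rw [abs_of_nonneg (sub_nonneg.2 hy)]
    exact (h x y hy).trans (le_abs_self _)
  · rw [abs_sub_comm, abs_sub_comm (f y), abs_of_nonneg (sub_nonneg.2 hy)]
    exact (h y x hy).trans (le_abs_self _)

/-- A continuous function with slope at least `δ > 0` is a bijection of the line. -/
theorem bijective_of_le_sub {f : ℝ → ℝ} (hf : Continuous f) {δ : ℝ}
    (hδ : 0 < δ) (h : ∀ x y, x ≤ y → δ * (y - x) ≤ f y - f x) : Function.Bijective f := by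
  have hmono : StrictMono f := fun x y hxy => by
    nlinarith [h x y hxy.le, mul_pos hδ (sub_pos.2 hxy)]
  refine ⟨hmono.injective, hf.surjective ?_ ?_⟩
  · refine tendsto_atTop_mono' atTop (f₁ := fun x => δ * x + f 0) ?_
      (tendsto_atTop_add_const_right _ _ (tendsto_id.const_mul_atTop hδ))
    filter_upwards [eventually_ge_atTop 0] with x hx
    linarith [h 0 x hx]
  · refine tendsto_atBot_mono' atBot ?_
      (tendsto_atBot_add_const_right _ _ (tendsto_id.const_mul_atBot hδ) :
        Tendsto (fun x => δ * x + f 0) atBot atBot)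
    filter_upwards [eventually_le_atBot 0] with x hx
    linarith [h x 0 hx]

namespace IsLabelData

variable {s : ℝ} {a b c : ℝ → ℝ} {K δ : ℝ}

theorem exists_lipschitzWith_flow (h : IsLabelData s a b c K δ) :
    ∃ C, LipschitzWith C (flow s a b c) := by
  obtain ⟨D₁, h1⟩ := exists_lipschitzWith_add_mul_time LipschitzWith.prod_snd s
  obtain ⟨D₂, h2⟩ := exists_lipschitzWith_add_mul_time LipschitzWith.prod_snd (-s)
  have hA := (lipschitzWith_primitive_of_bounded h.ma h.ba).comp h2
  have hB := (lipschitzWith_primitive_of_bounded h.mb h.bb).comp h1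
  have hC := (lipschitzWith_primitive_of_bounded h.mc h.bc).comp
    (LipschitzWith.prod_snd (α := ℝ) (β := ℝ))
  have e : flow s a b c = fun p => primitive c p.2
      + 1 / (2 * s) * (primitive b (p.2 + s * p.1) - primitive a (p.2 + -s * p.1)) := by
    funext p
    simp only [flow, neg_mul, ← sub_eq_add_neg]
    ring
  rw [e]
  exact ⟨_, hC.add ((lipschitzWith_const_mul (1 / (2 * s))).comp (hB.sub hA))⟩

theorem le_flow_sub (h : IsLabelData s a b c K δ) (t : ℝ) {y₁ y₂ : ℝ} (hy : y₁ ≤ y₂) :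
    δ * (y₂ - y₁) ≤ flow s a b c (t, y₂) - flow s a b c (t, y₁) := by
  have hs := h.s_pos
  have ia : ∀ σ x y : ℝ, IntervalIntegrable (fun ξ => a (ξ + σ)) volume x y := fun σ x y =>
    intervalIntegrable_of_bounded (h.ma.comp (measurable_id.add_const σ)).aestronglyMeasurable
      (Eventually.of_forall fun _ => h.ba _) x y
  have ib : ∀ σ x y : ℝ, IntervalIntegrable (fun ξ => b (ξ + σ)) volume x y := fun σ x y =>
    intervalIntegrable_of_bounded (h.mb.comp (measurable_id.add_const σ)).aestronglyMeasurable
      (Eventually.of_forall fun _ => h.bb _) x y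
  have ic : IntervalIntegrable c volume y₁ y₂ :=
    intervalIntegrable_of_bounded h.mc.aestronglyMeasurable (Eventually.of_forall h.bc) _ _
  have eC := primitive_sub h.mc.aestronglyMeasurable (Eventually.of_forall h.bc) y₁ y₂
  have eB := primitive_sub h.mb.aestronglyMeasurable (Eventually.of_forall h.bb)
    (y₁ + s * t) (y₂ + s * t)
  have eA := primitive_sub h.ma.aestronglyMeasurable (Eventually.of_forall h.ba)
    (y₁ + -(s * t)) (y₂ + -(s * t))
  rw [← intervalIntegral.integral_comp_add_right] at eA eB
  have e : flow s a b c (t, y₂) - flow s a b c (t, y₁)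
      = ∫ ξ in y₁..y₂, (c ξ + (b (ξ + s * t) - a (ξ + -(s * t))) / (2 * s)) := by
    rw [intervalIntegral.integral_add ic (((ib _ _ _).sub (ia _ _ _)).div_const _),
      intervalIntegral.integral_div, intervalIntegral.integral_sub (ib _ _ _) (ia _ _ _),
      ← eA, ← eB, ← eC]
    simp only [flow, sub_eq_add_neg]
    ring
  have hc : ∫ _ in y₁..y₂, δ = δ * (y₂ - y₁) := by simp [mul_comm]
  rw [e, ← hc]
  exact intervalIntegral.integral_mono_on hy intervalIntegrable_const
    (ic.add (((ib _ _ _).sub (ia _ _ _)).div_const _)) fun ξ _ => h.le_volume _ _ _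

theorem le_abs_flow_sub (h : IsLabelData s a b c K δ) (t y₁ y₂ : ℝ) :
    δ * |y₂ - y₁| ≤ |flow s a b c (t, y₂) - flow s a b c (t, y₁)| :=
  le_abs_sub_of_le_sub (f := fun y => flow s a b c (t, y))
    (fun _ _ => h.le_flow_sub t) y₁ y₂

theorem bijective_flow (h : IsLabelData s a b c K δ) (t : ℝ) :
    Function.Bijective fun y => flow s a b c (t, y) := by
  obtain ⟨C, hC⟩ := h.exists_lipschitzWith_flow
  exact bijective_of_le_sub (lipschitzWith_slice_space hC t).continuous h.δ_pos
    fun _ _ => h.le_flow_sub t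

variable {Y : ℝ × ℝ → ℝ}

/-- The inverse flow is Lipschitz in both variables: in space because the flow has slope at least
`δ`, in time because the flow has bounded speed. -/
theorem exists_lipschitzWith_label (h : IsLabelData s a b c K δ)
    (hY : ∀ p : ℝ × ℝ, flow s a b c (p.1, Y p) = p.2) : ∃ C, LipschitzWith C Y := by
  obtain ⟨C, hC⟩ := h.exists_lipschitzWith_flow
  have hδ := h.δ_pos
  refine ⟨((1 + C) / δ).toNNReal, LipschitzWith.of_dist_le' fun p q => ?_⟩
  have h1 := h.le_abs_flow_sub p.1 (Y q) (Y p)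
  have h2 := hC.dist_le_mul (q.1, Y q) (p.1, Y q)
  have h3 : dist (q.1, Y q) (p.1, Y q) = |p.1 - q.1| := by
    simp [Prod.dist_eq, Real.dist_eq, abs_sub_comm]
  rw [h3, Real.dist_eq, hY q] at h2
  rw [hY p] at h1
  have d1 : |p.1 - q.1| ≤ dist p q := (Real.dist_eq p.1 q.1) ▸ le_max_left _ _
  have d2 : |p.2 - q.2| ≤ dist p q := (Real.dist_eq p.2 q.2) ▸ le_max_right _ _
  have h4 := abs_sub_le p.2 q.2 (flow s a b c (p.1, Y q))
  rw [Real.dist_eq, div_mul_eq_mul_div, le_div_iff₀ hδ, mul_comm]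
  have h5 : (C : ℝ) * |p.1 - q.1| ≤ C * dist p q := mul_le_mul_of_nonneg_left d1 C.2
  linarith

/-- Almost every property of labels holds almost everywhere along each characteristic family. -/
theorem ae_comp_label (h : IsLabelData s a b c K δ)
    (hY : ∀ p : ℝ × ℝ, flow s a b c (p.1, Y p) = p.2) {q : ℝ → Prop} (hq : ∀ᵐ y, q y) (σ : ℝ) :
    ∀ᵐ p : ℝ × ℝ, q (Y p + σ * p.1) := by
  obtain ⟨C, hC⟩ := h.exists_lipschitzWith_flow
  obtain ⟨C', hC'⟩ := h.exists_lipschitzWith_label hY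
  have hm : Measurable fun p : ℝ × ℝ => Y p + σ * p.1 :=
    hC'.continuous.measurable.add (measurable_fst.const_mul σ)
  rw [Measure.volume_eq_prod]
  refine ae_comp_of_ae_slice hm (fun r hr => Eventually.of_forall fun t => ?_) hq
  have hanti : AntilipschitzWith C fun x => Y (t, x) := by
    refine AntilipschitzWith.of_le_mul_dist fun x x' => ?_
    have := (lipschitzWith_slice_space hC t).dist_le_mul (Y (t, x)) (Y (t, x'))
    rwa [hY (t, x), hY (t, x')] at this
  exact ae_comp_of_antilipschitzWith hanti (ae_shift hr (σ * t))

/-- The differential of the inverse flow. -/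
theorem ae_hasFDerivAt_label (h : IsLabelData s a b c K δ)
    (hY : ∀ p : ℝ × ℝ, flow s a b c (p.1, Y p) = p.2) :
    ∀ᵐ p : ℝ × ℝ, HasFDerivAt Y (covector
      (-(1 / (c (Y p) + (b (Y p + s * p.1) - a (Y p + -s * p.1)) / (2 * s))
        * ((b (Y p + s * p.1) + a (Y p + -s * p.1)) / 2)))
      (1 / (c (Y p) + (b (Y p + s * p.1) - a (Y p + -s * p.1)) / (2 * s)))) p := by
  obtain ⟨C', hC'⟩ := h.exists_lipschitzWith_label hY
  have hc := h.ae_comp_label hY (ae_hasDerivAt_primitive_of_bounded h.mc h.bc) 0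
  filter_upwards [hC'.ae_hasFDerivAt_covector, hc,
    h.ae_comp_label hY (ae_hasDerivAt_primitive_of_bounded h.mb h.bb) s,
    h.ae_comp_label hY (ae_hasDerivAt_primitive_of_bounded h.ma h.ba) (-s)] with p h1 h2 h3 h4
  simp only [zero_mul, add_zero] at h2
  have h5 := hasFDerivAt_flow_comp h.s_pos.ne' h1 h2 h3 h4
  have e : (fun q : ℝ × ℝ => flow s a b c (q.1, Y q)) = fun q => q.2 := funext hY
  rw [e] at h5
  have ht := timeDeriv_of_hasFDerivAt h5
  have hx := spaceDeriv_of_hasFDerivAt h5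
  rw [timeDeriv_of_hasFDerivAt hasFDerivAt_snd_covector] at ht
  rw [spaceDeriv_of_hasFDerivAt hasFDerivAt_snd_covector] at hx
  have hω := h.δ_pos.trans_le (h.le_volume (Y p) (Y p + s * p.1) (Y p + -s * p.1))
  set m := c (Y p) + (b (Y p + s * p.1) - a (Y p + -s * p.1)) / (2 * s)
  have ex : spaceDeriv Y p = 1 / m := by rw [eq_div_iff hω.ne']; linarith
  have et : timeDeriv Y p = -(1 / m * ((b (Y p + s * p.1) + a (Y p + -s * p.1)) / 2)) := by
    rw [← mul_right_inj' hω.ne', mul_neg, ← mul_assoc, mul_one_div_cancel hω.ne', one_mul]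
    linarith
  rwa [ex, et] at h1

end IsLabelData

/-! ### Label data of the Cauchy problem -/

/-- At the label `y` the functions `a`, `b`, `c` take the values of `u₀ + s v₀`, `u₀ - s v₀` and
`v₀ + 1 / ρ₀` at `X₀(y)`, and `ρ₀` is positive there. -/
def IsGoodLabel (s : ℝ) (ρ₀ u₀ v₀ a b c : ℝ → ℝ) (y : ℝ) : Prop :=
  0 < ρ₀ (lagX₀ ρ₀ y) ∧ a y = u₀ (lagX₀ ρ₀ y) + s * v₀ (lagX₀ ρ₀ y) ∧
    b y = u₀ (lagX₀ ρ₀ y) - s * v₀ (lagX₀ ρ₀ y) ∧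
    c y = v₀ (lagX₀ ρ₀ y) + 1 / ρ₀ (lagX₀ ρ₀ y)

/-- Label data `a`, `b`, `c` representing the initial values `(ρ₀, u₀, v₀)`: up to null sets
`a = u₀ + s v₀`, `b = u₀ - s v₀`, `c = v₀ + 1 / ρ₀`, composed with `X₀`. -/
structure IsInitialLabelData (s : ℝ) (ρ₀ u₀ v₀ a b c : ℝ → ℝ) (K δ : ℝ) : Prop
    extends IsLabelData s a b c K δ where
  bijective_lagY₀ : Function.Bijective (lagY₀ ρ₀)
  lipschitzWith_lagY₀ : ∃ C, LipschitzWith C (lagY₀ ρ₀)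
  hasDerivAt_lagY₀ : ∀ᵐ x, HasDerivAt (lagY₀ ρ₀) (ρ₀ x) x
  le_abs_lagY₀_sub : ∃ k > 0, ∀ x x', k * |x' - x| ≤ |lagY₀ ρ₀ x' - lagY₀ ρ₀ x|
  ae_label : ∀ᵐ y, IsGoodLabel s ρ₀ u₀ v₀ a b c y

/-- Almost everywhere bounds may be made to hold everywhere for a Borel representative. -/
theorem exists_measurable_of_ae_mem_Icc {f : ℝ → ℝ} {l r : ℝ} (hf : AEStronglyMeasurable f volume)
    (h : ∀ᵐ x, l ≤ f x ∧ f x ≤ r) :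
    ∃ g : ℝ → ℝ, Measurable g ∧ (∀ x, l ≤ g x ∧ g x ≤ r) ∧ f =ᵐ[volume] g := by
  obtain ⟨x, hx⟩ := h.exists
  refine ⟨fun x => max l (min r (hf.mk f x)),
    measurable_const.max (measurable_const.min hf.stronglyMeasurable_mk.measurable),
    fun y => ⟨le_max_left _ _, max_le (hx.1.trans hx.2) (min_le_left _ _)⟩, ?_⟩
  filter_upwards [h, hf.ae_eq_mk] with y hy hye
  rw [← hye, min_eq_right hy.2, max_eq_right hy.1]

/-- H1 provides label data: the lower bound for the specific volume is
`c₅ - (c₄ - c₁) / (2 s)`. -/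
theorem exists_initialLabelData {s : ℝ} (hs : 0 < s) {ρ₀ u₀ v₀ : ℝ → ℝ}
    (hρ₀ : MemLp ρ₀ ⊤ volume) (hu₀ : MemLp u₀ ⊤ volume) (hv₀ : MemLp v₀ ⊤ volume)
    {ρmin : ℝ} (hρmin : 0 < ρmin) (hlow : ∀ᵐ x, ρmin ≤ ρ₀ x) (hH1 : HypH1 s ρ₀ u₀ v₀) :
    ∃ (a b c : ℝ → ℝ) (K δ : ℝ), IsInitialLabelData s ρ₀ u₀ v₀ a b c K δ := by
  obtain ⟨c₁, c₂, c₃, c₄, c₅, h1, h2, h3, h4⟩ := hH1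
  obtain ⟨Kρ, -, hKρ⟩ := ae_abs_le_of_memLp_top hρ₀
  obtain ⟨Kv, -, hKv⟩ := ae_abs_le_of_memLp_top hv₀
  have hlip : LipschitzWith Kρ.toNNReal (lagY₀ ρ₀) := lipschitzWith_primitive hρ₀.1 hKρ
  have hle : ∀ x y, x ≤ y → ρmin * (y - x) ≤ lagY₀ ρ₀ y - lagY₀ ρ₀ x := by
    intro x y hxy
    have e : lagY₀ ρ₀ y - lagY₀ ρ₀ x = ∫ ξ in x..y, ρ₀ ξ := primitive_sub hρ₀.1 hKρ x y
    have hc : ∫ _ in x..y, ρmin = ρmin * (y - x) := by simp [mul_comm]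
    rw [e, ← hc]
    exact intervalIntegral.integral_mono_ae hxy intervalIntegrable_const
      (intervalIntegrable_of_bounded hρ₀.1 hKρ x y) hlow
  have hbij : Function.Bijective (lagY₀ ρ₀) := bijective_of_le_sub hlip.continuous hρmin hle
  have hYX : ∀ y, lagY₀ ρ₀ (lagX₀ ρ₀ y) = y := fun y =>
    Function.rightInverse_invFun hbij.surjective y
  have hXanti : AntilipschitzWith Kρ.toNNReal (lagX₀ ρ₀) := by
    refine AntilipschitzWith.of_le_mul_dist fun y y' => ?_
    have := hlip.dist_le_mul (lagX₀ ρ₀ y) (lagX₀ ρ₀ y')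
    rwa [hYX, hYX] at this
  have hXm : Measurable (lagX₀ ρ₀) := by
    have : LipschitzWith (1 / ρmin).toNNReal (lagX₀ ρ₀) := by
      refine LipschitzWith.of_dist_le' fun y y' => ?_
      have := le_abs_sub_of_le_sub hle (lagX₀ ρ₀ y') (lagX₀ ρ₀ y)
      rw [hYX, hYX] at this
      rw [Real.dist_eq, Real.dist_eq, one_div_mul_eq_div, le_div_iff₀ hρmin, mul_comm]
      exact this
    exact this.continuous.measurable
  have h3' : ∀ᵐ x, c₅ ≤ v₀ x + 1 / ρ₀ x ∧ v₀ x + 1 / ρ₀ x ≤ Kv + 1 / ρmin := by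
    filter_upwards [h3, hKv, hlow] with x hx hxv hxl
    exact ⟨le_of_lt hx, add_le_add ((le_abs_self _).trans hxv)
      (one_div_le_one_div_of_le hρmin hxl)⟩
  obtain ⟨ga, hga, hgab, hgae⟩ := exists_measurable_of_ae_mem_Icc
    (hu₀.1.add (hv₀.1.const_mul s)) h2
  obtain ⟨gb, hgb, hgbb, hgbe⟩ := exists_measurable_of_ae_mem_Icc
    (hu₀.1.sub (hv₀.1.const_mul s)) h1
  obtain ⟨gc, hgc, hgcb, hgce⟩ := exists_measurable_of_ae_mem_Icc
    (hv₀.1.add (hρ₀.1.aemeasurable.const_div 1).aestronglyMeasurable) h3'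
  have habs : ∀ {l r z : ℝ}, l ≤ z ∧ z ≤ r → |z| ≤ |l| + |r| := fun {l r z} h =>
    abs_le.2 ⟨by linarith [neg_abs_le l, abs_nonneg r, h.1], by
      linarith [le_abs_self r, abs_nonneg l, h.2]⟩
  set K := (|c₃| + |c₄|) + (|c₁| + |c₂|) + (|c₅| + |Kv + 1 / ρmin|) with hK
  refine ⟨ga ∘ lagX₀ ρ₀, gb ∘ lagX₀ ρ₀, gc ∘ lagX₀ ρ₀, K, c₅ - (c₄ - c₁) / (2 * s), ?_⟩
  have pos := fun r : ℝ => abs_nonneg r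
  refine
    { s_pos := hs
      δ_pos := h4
      ma := hga.comp hXm
      mb := hgb.comp hXm
      mc := hgc.comp hXm
      ba := fun y => (habs (hgab _)).trans ?_
      bb := fun y => (habs (hgbb _)).trans ?_
      bc := fun y => (habs (hgcb _)).trans ?_
      le_volume := fun y y' y'' => ?_
      bijective_lagY₀ := hbij
      lipschitzWith_lagY₀ := ⟨_, hlip⟩
      hasDerivAt_lagY₀ := ae_hasDerivAt_primitive hρ₀.1 hKρ
      le_abs_lagY₀_sub := ⟨ρmin, hρmin, le_abs_sub_of_le_sub hle⟩
      ae_label := ?_ }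
  · linarith [pos c₁, pos c₂, pos c₅, pos (Kv + 1 / ρmin)]
  · linarith [pos c₃, pos c₄, pos c₅, pos (Kv + 1 / ρmin)]
  · linarith [pos c₃, pos c₄, pos c₁, pos c₂]
  · have e : c₅ - (c₄ - c₁) / (2 * s) = c₅ + (c₁ - c₄) / (2 * s) := by ring
    rw [e]
    simp only [Function.comp_apply]
    have := (hgab (lagX₀ ρ₀ y'')).2
    have := (hgbb (lagX₀ ρ₀ y')).1
    have := (hgcb (lagX₀ ρ₀ y)).1
    gcongr
  · refine ae_comp_of_antilipschitzWith hXanti (q := fun x => 0 < ρ₀ x ∧ ga x = u₀ x + s * v₀ x ∧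
      gb x = u₀ x - s * v₀ x ∧ gc x = v₀ x + 1 / ρ₀ x) ?_
    filter_upwards [hgae, hgbe, hgce, hlow] with x e1 e2 e3 e4
    exact ⟨hρmin.trans_le e4, e1.symm, e2.symm, e3.symm⟩

namespace IsInitialLabelData

variable {s : ℝ} {ρ₀ u₀ v₀ a b c : ℝ → ℝ} {K δ : ℝ}

theorem lagX₀_lagY₀ (h : IsInitialLabelData s ρ₀ u₀ v₀ a b c K δ) (x : ℝ) :
    lagX₀ ρ₀ (lagY₀ ρ₀ x) = x :=
  Function.leftInverse_invFun h.bijective_lagY₀.injective x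

theorem ae_comp_lagY₀ (h : IsInitialLabelData s ρ₀ u₀ v₀ a b c K δ) {q : ℝ → Prop}
    (hq : ∀ᵐ y, q y) : ∀ᵐ x, q (lagY₀ ρ₀ x) := by
  obtain ⟨k, hk, hk'⟩ := h.le_abs_lagY₀_sub
  have hanti : AntilipschitzWith (1 / k).toNNReal (lagY₀ ρ₀) := by
    refine AntilipschitzWith.of_le_mul_dist fun x x' => ?_
    rw [Real.coe_toNNReal _ (by positivity), one_div_mul_eq_div, le_div_iff₀ hk, mul_comm]
    exact hk' x' x
  exact ae_comp_of_antilipschitzWith hanti hq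

theorem ae_initial (h : IsInitialLabelData s ρ₀ u₀ v₀ a b c K δ) :
    ∀ᵐ x, 0 < ρ₀ x ∧ a (lagY₀ ρ₀ x) = u₀ x + s * v₀ x ∧
      b (lagY₀ ρ₀ x) = u₀ x - s * v₀ x ∧ c (lagY₀ ρ₀ x) = v₀ x + 1 / ρ₀ x := by
  simpa only [IsGoodLabel, h.lagX₀_lagY₀] using h.ae_comp_lagY₀ h.ae_label

/-- The change of variables `y = Y₀(x)` under the integral of a bounded Borel function. -/
theorem hasDerivAt_primitive_lagY₀ (h : IsInitialLabelData s ρ₀ u₀ v₀ a b c K δ) {f : ℝ → ℝ}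
    {L : ℝ} (hf : Measurable f) (hL : ∀ y, |f y| ≤ L) :
    ∀ᵐ x, HasDerivAt (fun x => primitive f (lagY₀ ρ₀ x)) (ρ₀ x * f (lagY₀ ρ₀ x)) x := by
  filter_upwards [h.ae_comp_lagY₀ (ae_hasDerivAt_primitive_of_bounded hf hL),
    h.hasDerivAt_lagY₀] with x h1 h2
  rw [mul_comm]
  exact h1.comp x h2

theorem lagY₀_zero : lagY₀ ρ₀ 0 = 0 := by simp [lagY₀]

theorem primitive_lagY₀ (h : IsInitialLabelData s ρ₀ u₀ v₀ a b c K δ) {f : ℝ → ℝ}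
    {L : ℝ} (hf : Measurable f) (hL : ∀ y, |f y| ≤ L) {g : ℝ → ℝ}
    (hg : ∀ᵐ x, ρ₀ x * f (lagY₀ ρ₀ x) = g x) (x : ℝ) :
    primitive f (lagY₀ ρ₀ x) = primitive g x := by
  obtain ⟨C, hC⟩ := h.lipschitzWith_lagY₀
  have h1 := ((lipschitzWith_primitive_of_bounded hf hL).comp hC).sub_eq_intervalIntegral (g := g)
    (by
      filter_upwards [h.hasDerivAt_primitive_lagY₀ hf hL, hg] with x h1 h2
      rwa [h2] at h1) 0 x
  simpa [lagY₀_zero, primitive] using h1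

/-- At time zero the specific volume is `1 / ρ₀`, so the flow starts from `X₀`. -/
theorem flow_lagY₀ (h : IsInitialLabelData s ρ₀ u₀ v₀ a b c K δ) (x : ℝ) :
    flow s a b c (0, lagY₀ ρ₀ x) = x := by
  have hs := h.s_pos
  have hf : Measurable fun y => c y + (b y - a y) / (2 * s) :=
    h.mc.add ((h.mb.sub h.ma).div_const _)
  have hb : ∀ y, |c y + (b y - a y) / (2 * s)| ≤ K + (K + K) / (2 * s) := by
    intro y
    refine (abs_add_le _ _).trans (add_le_add (h.bc y) ?_)
    rw [abs_div, abs_of_pos (by positivity : 0 < 2 * s)]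
    have := (abs_sub (b y) (a y)).trans (add_le_add (h.bb y) (h.ba y))
    gcongr
  have h1 := h.primitive_lagY₀ hf hb (g := fun _ => 1) (by
    filter_upwards [h.ae_initial] with x ⟨h0, h1, h2, h3⟩
    rw [h1, h2, h3]
    field_simp
    ring) x
  have ia : ∀ x y : ℝ, IntervalIntegrable a volume x y :=
    intervalIntegrable_of_bounded h.ma.aestronglyMeasurable (Eventually.of_forall h.ba)
  have ib : ∀ x y : ℝ, IntervalIntegrable b volume x y :=
    intervalIntegrable_of_bounded h.mb.aestronglyMeasurable (Eventually.of_forall h.bb)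
  have ic : ∀ x y : ℝ, IntervalIntegrable c volume x y :=
    intervalIntegrable_of_bounded h.mc.aestronglyMeasurable (Eventually.of_forall h.bc)
  have h2 : primitive (fun _ => (1 : ℝ)) x = x := by simp [primitive]
  rw [h2] at h1
  refine Eq.trans ?_ h1
  simp only [flow, primitive, mul_zero, add_zero, sub_zero]
  rw [intervalIntegral.integral_add (ic _ _) (((ib _ _).sub (ia _ _)).div_const _),
    intervalIntegral.integral_div, intervalIntegral.integral_sub (ib _ _) (ia _ _)]

theorem lagX_eq_flow (h : IsInitialLabelData s ρ₀ u₀ v₀ a b c K δ) (t y : ℝ) :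
    lagX s ρ₀ u₀ v₀ t y = flow s a b c (t, y) := by
  have hs := h.s_pos
  have ia : ∀ x y : ℝ, IntervalIntegrable a volume x y :=
    intervalIntegrable_of_bounded h.ma.aestronglyMeasurable (Eventually.of_forall h.ba)
  have ib : ∀ x y : ℝ, IntervalIntegrable b volume x y :=
    intervalIntegrable_of_bounded h.mb.aestronglyMeasurable (Eventually.of_forall h.bb)
  have eU : ∀ p q, ∫ ξ in p..q, u₀ (lagX₀ ρ₀ ξ)
      = 1 / 2 * ((primitive a q - primitive a p) + (primitive b q - primitive b p)) := by
    intro p q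
    rw [primitive_sub h.ma.aestronglyMeasurable (Eventually.of_forall h.ba),
      primitive_sub h.mb.aestronglyMeasurable (Eventually.of_forall h.bb),
      ← intervalIntegral.integral_add (ia _ _) (ib _ _), ← intervalIntegral.integral_const_mul]
    refine intervalIntegral.integral_congr_ae ?_
    filter_upwards [h.ae_label] with y ⟨_, h1, h2, _⟩ _
    rw [h1, h2]; ring
  have eV : ∀ q, ∫ ξ in (0 : ℝ)..q, v₀ (lagX₀ ρ₀ ξ)
      = 1 / (2 * s) * (primitive a q - primitive b q) := by
    intro q
    simp only [primitive]
    rw [← intervalIntegral.integral_sub (ia _ _) (ib _ _), ← intervalIntegral.integral_const_mul]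
    refine intervalIntegral.integral_congr_ae ?_
    filter_upwards [h.ae_label] with y ⟨_, h1, h2, _⟩ _
    rw [h1, h2]; field_simp; ring
  have eW : ∫ ξ in (0 : ℝ)..y, (v₀ (lagX₀ ρ₀ ξ) + 1 / ρ₀ (lagX₀ ρ₀ ξ)) = primitive c y := by
    refine intervalIntegral.integral_congr_ae ?_
    filter_upwards [h.ae_label] with y ⟨_, _, _, h3⟩ _
    rw [h3]
  rw [lagX, eU, eV, eV, eW, flow]
  field_simp
  ring

theorem bijective_lagX (h : IsInitialLabelData s ρ₀ u₀ v₀ a b c K δ) (t : ℝ) :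
    Function.Bijective (lagX s ρ₀ u₀ v₀ t) := by
  rw [funext (h.lagX_eq_flow t)]
  exact h.bijective_flow t

theorem lagY_lagX (h : IsInitialLabelData s ρ₀ u₀ v₀ a b c K δ) (t y : ℝ) :
    lagY s ρ₀ u₀ v₀ t (lagX s ρ₀ u₀ v₀ t y) = y :=
  Function.leftInverse_invFun (h.bijective_lagX t).injective y

theorem flow_lagY (h : IsInitialLabelData s ρ₀ u₀ v₀ a b c K δ) (p : ℝ × ℝ) :
    flow s a b c (p.1, lagY s ρ₀ u₀ v₀ p.1 p.2) = p.2 := by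
  rw [← h.lagX_eq_flow]
  exact Function.rightInverse_invFun (h.bijective_lagX p.1).surjective p.2

theorem lagY_zero (h : IsInitialLabelData s ρ₀ u₀ v₀ a b c K δ) (x : ℝ) :
    lagY s ρ₀ u₀ v₀ 0 x = lagY₀ ρ₀ x := by
  refine (h.bijective_flow 0).injective ?_
  exact (h.flow_lagY (0, x)).trans (h.flow_lagY₀ x).symm

end IsInitialLabelData

/-! ### The explicit solution -/

theorem ae_comp_shift {q : ℝ → Prop} (hq : ∀ᵐ y, q y) (σ : ℝ) :
    ∀ᵐ p : ℝ × ℝ, q (p.2 + σ * p.1) := by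
  rw [Measure.volume_eq_prod]
  exact ae_comp_of_ae_slice (f := fun p => p.2 + σ * p.1) (by fun_prop)
    (fun r hr => Eventually.of_forall fun t => ae_shift hr (σ * t)) hq

theorem IsLocallyBounded.exists_comp_bound {F a : ℝ → ℝ} {K : ℝ} (hF : IsLocallyBounded F)
    (ha : ∀ y, |a y| ≤ K) : ∃ C, ∀ y, |F (a y)| ≤ C := by
  obtain ⟨C, hC⟩ := hF K
  exact ⟨C, fun y => hC _ (ha y)⟩

theorem locallyIntegrableOn_halfPlane {f : ℝ × ℝ → ℝ} (hf : MemLp f ⊤ halfPlaneMeasure) :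
    LocallyIntegrableOn f halfPlane := by
  have : IsLocallyFiniteMeasure halfPlaneMeasure := by
    unfold halfPlaneMeasure
    infer_instance
  have : LocallyIntegrable f halfPlaneMeasure := hf.locallyIntegrable le_top
  exact locallyIntegrableOn_of_locallyIntegrable_restrict this

theorem IsWeakCauchySolution.isDistributionalSolution {w f : ℝ → ℝ → ℝ} {w₀ : ℝ → ℝ}
    (h : IsWeakCauchySolution w f w₀)
    (hw : MemLp (fun p : ℝ × ℝ => w p.1 p.2) ⊤ halfPlaneMeasure)
    (hf : MemLp (fun p : ℝ × ℝ => f p.1 p.2) ⊤ halfPlaneMeasure) :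
    IsDistributionalSolution w f := by
  refine ⟨locallyIntegrableOn_halfPlane hw, locallyIntegrableOn_halfPlane hf, fun φ hφ hs => ?_⟩
  have h0 : ∀ x, φ (0, x) = 0 := fun x => by
    by_contra hne
    have : (0, x) ∈ halfPlane := hs (subset_tsupport φ hne)
    exact lt_irrefl (0 : ℝ) this.1
  simpa [h0] using h φ hφ

/-- A wave potential in Lagrangian coordinates: the combination of a primitive of `b`, constant
along `y + s t`, and one of `a`, constant along `y - s t`. -/
theorem hasFDerivAt_wave {s : ℝ} {a b : ℝ → ℝ} {p : ℝ × ℝ} (α β : ℝ)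
    (hb : HasDerivAt (primitive b) (b (p.2 + s * p.1)) (p.2 + s * p.1))
    (ha : HasDerivAt (primitive a) (a (p.2 + -s * p.1)) (p.2 + -s * p.1)) :
    HasFDerivAt (fun q : ℝ × ℝ => α * primitive b (q.2 + s * q.1)
        + β * primitive a (q.2 + -s * q.1))
      (covector (s * (α * b (p.2 + s * p.1) - β * a (p.2 + -s * p.1)))
        (α * b (p.2 + s * p.1) + β * a (p.2 + -s * p.1))) p := by
  have h := hasFDerivAt_add_covector
    (hasFDerivAt_const_mul_covector α
      (HasDerivAt.comp_covector hb (hasFDerivAt_add_mul_time hasFDerivAt_snd_covector s)))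
    (hasFDerivAt_const_mul_covector β
      (HasDerivAt.comp_covector ha (hasFDerivAt_add_mul_time hasFDerivAt_snd_covector (-s))))
  convert h using 2 <;> ring

namespace IsInitialLabelData

variable {s : ℝ} {ρ₀ u₀ v₀ a b c : ℝ → ℝ} {K δ : ℝ}

/-- The explicit solution in terms of the label data, at a point of the half plane whose label and
the feet of its two characteristics are good labels. -/
theorem explicit_eq (h : IsInitialLabelData s ρ₀ u₀ v₀ a b c K δ) {t x y : ℝ}
    (hy : lagY s ρ₀ u₀ v₀ t x = y) (h0 : IsGoodLabel s ρ₀ u₀ v₀ a b c y)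
    (h1 : IsGoodLabel s ρ₀ u₀ v₀ a b c (y + s * t))
    (h2 : IsGoodLabel s ρ₀ u₀ v₀ a b c (y + -s * t)) :
    uSol s ρ₀ u₀ v₀ t x = (b (y + s * t) + a (y + -s * t)) / 2 ∧
    vSol s ρ₀ u₀ v₀ t x = (a (y + -s * t) - b (y + s * t)) / (2 * s) ∧
    rhoSol s ρ₀ u₀ v₀ t x = 1 / (c y + (b (y + s * t) - a (y + -s * t)) / (2 * s)) := by
  have hs := h.s_pos
  obtain ⟨r0, -, -, ec⟩ := h0
  obtain ⟨-, -, eb, -⟩ := h1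
  obtain ⟨-, ea, -, -⟩ := h2
  have hv : vSol s ρ₀ u₀ v₀ t x = (a (y + -s * t) - b (y + s * t)) / (2 * s) := by
    rw [ea, eb]
    simp only [vSol, UpsilonPlus, GammaMinus, atLabel, hy, neg_mul]
    field_simp
    ring
  refine ⟨?_, hv, ?_⟩
  · rw [ea, eb]
    simp only [uSol, UpsilonMinus, GammaPlus, atLabel, hy, neg_mul]
    ring
  · rw [rhoSol, hv, hy, ec]
    set A := a (y + -s * t)
    set B := b (y + s * t)
    set r := ρ₀ (lagX₀ ρ₀ y)
    have e : 1 + r * (v₀ (lagX₀ ρ₀ y) - (A - B) / (2 * s))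
        = r * (v₀ (lagX₀ ρ₀ y) + 1 / r + (B - A) / (2 * s)) := by
      field_simp
      ring
    rw [e, ← div_div, div_self r0.ne']

/-- The explicit solution transports its Riemann invariants along `Y ± s t`, and `v + 1 / ρ` along
`Y`; the differential of `Y` is `ρ dx - ρ u dt`. -/
theorem ae_explicit (h : IsInitialLabelData s ρ₀ u₀ v₀ a b c K δ) :
    ∀ᵐ p : ℝ × ℝ,
      uSol s ρ₀ u₀ v₀ p.1 p.2 + s * vSol s ρ₀ u₀ v₀ p.1 p.2
        = a (lagY s ρ₀ u₀ v₀ p.1 p.2 + -s * p.1) ∧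
      uSol s ρ₀ u₀ v₀ p.1 p.2 - s * vSol s ρ₀ u₀ v₀ p.1 p.2
        = b (lagY s ρ₀ u₀ v₀ p.1 p.2 + s * p.1) ∧
      vSol s ρ₀ u₀ v₀ p.1 p.2 + 1 / rhoSol s ρ₀ u₀ v₀ p.1 p.2 = c (lagY s ρ₀ u₀ v₀ p.1 p.2) ∧
      0 < rhoSol s ρ₀ u₀ v₀ p.1 p.2 ∧
      HasFDerivAt (fun q : ℝ × ℝ => lagY s ρ₀ u₀ v₀ q.1 q.2)
        (covector (-(rhoSol s ρ₀ u₀ v₀ p.1 p.2 * uSol s ρ₀ u₀ v₀ p.1 p.2))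
          (rhoSol s ρ₀ u₀ v₀ p.1 p.2)) p := by
  have hs := h.s_pos
  have hl := h.toIsLabelData.ae_comp_label h.flow_lagY h.ae_label
  filter_upwards [hl 0, hl s, hl (-s), h.toIsLabelData.ae_hasFDerivAt_label h.flow_lagY]
    with p h0 h1 h2 h3
  simp only [zero_mul, add_zero] at h0
  obtain ⟨eu, ev, er⟩ := h.explicit_eq rfl h0 h1 h2
  have hm := h.δ_pos.trans_le (h.le_volume (lagY s ρ₀ u₀ v₀ p.1 p.2)
    (lagY s ρ₀ u₀ v₀ p.1 p.2 + s * p.1) (lagY s ρ₀ u₀ v₀ p.1 p.2 + -s * p.1))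
  rw [eu, ev, er]
  refine ⟨?_, ?_, ?_, by positivity, h3⟩
  · field_simp
    ring
  · field_simp
    ring
  · rw [one_div_one_div]
    ring

theorem exists_lipschitzWith_lagY (h : IsInitialLabelData s ρ₀ u₀ v₀ a b c K δ) :
    ∃ C, LipschitzWith C fun p : ℝ × ℝ => lagY s ρ₀ u₀ v₀ p.1 p.2 :=
  h.toIsLabelData.exists_lipschitzWith_label h.flow_lagY

/-- Functions of the labels transported along the three characteristic families solve a Cauchy
problem: a primitive of `f`, evaluated at `Y - σ t`, is a potential for the density
`ρ f(Y - σ t)` with flux `(ρ u + σ) f(Y - σ t)`. -/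
theorem isWeakCauchySolution_of_labels (h : IsInitialLabelData s ρ₀ u₀ v₀ a b c K δ)
    {F G H : ℝ → ℝ} {L₁ L₂ L₃ : ℝ} (hF : Measurable F) (hG : Measurable G) (hH : Measurable H)
    (bF : ∀ y, |F y| ≤ L₁) (bG : ∀ y, |G y| ≤ L₂) (bH : ∀ y, |H y| ≤ L₃)
    {w f : ℝ → ℝ → ℝ} {w₀ : ℝ → ℝ}
    (hw : ∀ᵐ p : ℝ × ℝ, w p.1 p.2 = rhoSol s ρ₀ u₀ v₀ p.1 p.2 *
      (F (lagY s ρ₀ u₀ v₀ p.1 p.2 + -s * p.1) + G (lagY s ρ₀ u₀ v₀ p.1 p.2 + s * p.1)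
        + H (lagY s ρ₀ u₀ v₀ p.1 p.2)))
    (hf : ∀ᵐ p : ℝ × ℝ, f p.1 p.2 =
      (rhoSol s ρ₀ u₀ v₀ p.1 p.2 * uSol s ρ₀ u₀ v₀ p.1 p.2 + s)
          * F (lagY s ρ₀ u₀ v₀ p.1 p.2 + -s * p.1)
        + (rhoSol s ρ₀ u₀ v₀ p.1 p.2 * uSol s ρ₀ u₀ v₀ p.1 p.2 - s)
          * G (lagY s ρ₀ u₀ v₀ p.1 p.2 + s * p.1)
        + rhoSol s ρ₀ u₀ v₀ p.1 p.2 * uSol s ρ₀ u₀ v₀ p.1 p.2 * H (lagY s ρ₀ u₀ v₀ p.1 p.2))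
    (hw₀ : ∀ᵐ x, w₀ x = ρ₀ x * (F (lagY₀ ρ₀ x) + G (lagY₀ ρ₀ x) + H (lagY₀ ρ₀ x))) :
    MemLp (fun p : ℝ × ℝ => w p.1 p.2) ⊤ halfPlaneMeasure ∧
      MemLp (fun p : ℝ × ℝ => f p.1 p.2) ⊤ halfPlaneMeasure ∧ IsWeakCauchySolution w f w₀ := by
  obtain ⟨C, hC⟩ := h.exists_lipschitzWith_lagY
  obtain ⟨C₁, hC₁⟩ := exists_lipschitzWith_add_mul_time hC (-s)
  obtain ⟨C₂, hC₂⟩ := exists_lipschitzWith_add_mul_time hC s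
  set P : ℝ × ℝ → ℝ := fun p => primitive F (lagY s ρ₀ u₀ v₀ p.1 p.2 + -s * p.1)
    + primitive G (lagY s ρ₀ u₀ v₀ p.1 p.2 + s * p.1)
    + primitive H (lagY s ρ₀ u₀ v₀ p.1 p.2) with hP
  have hlip := (((lipschitzWith_primitive_of_bounded hF bF).comp hC₁).add
    ((lipschitzWith_primitive_of_bounded hG bG).comp hC₂)).add
    ((lipschitzWith_primitive_of_bounded hH bH).comp hC)
  have hl := fun {q : ℝ → Prop} (hq : ∀ᵐ y, q y) σ => h.toIsLabelData.ae_comp_label h.flow_lagY hq σ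
  have hd : ∀ᵐ p ∂halfPlaneMeasure, HasFDerivAt P (covector (-f p.1 p.2) (w p.1 p.2)) p := by
    refine ae_halfPlane_of_ae ?_
    filter_upwards [hw, hf, h.ae_explicit, hl (ae_hasDerivAt_primitive_of_bounded hF bF) (-s),
      hl (ae_hasDerivAt_primitive_of_bounded hG bG) s,
      hl (ae_hasDerivAt_primitive_of_bounded hH bH) 0] with p ew ef ⟨_, _, _, _, hYd⟩ dF dG dH
    simp only [zero_mul, add_zero] at dH
    have hd := hasFDerivAt_add_covector (hasFDerivAt_add_covector
      (HasDerivAt.comp_covector dF (hasFDerivAt_add_mul_time hYd (-s)))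
      (HasDerivAt.comp_covector dG (hasFDerivAt_add_mul_time hYd s)))
      (dH.comp_covector hYd)
    rw [ew, ef]
    convert hd using 2 <;> ring
  obtain ⟨m1, m2⟩ := memLp_of_potential hlip hd
  refine ⟨m1, m2, isWeakCauchySolution_of_potential hlip hd ?_⟩
  have e : (fun x => P (0, x)) = fun x => primitive F (lagY₀ ρ₀ x) + primitive G (lagY₀ ρ₀ x)
      + primitive H (lagY₀ ρ₀ x) := by
    funext x
    simp only [hP, mul_zero, add_zero, h.lagY_zero]
  filter_upwards [hw₀, h.hasDerivAt_primitive_lagY₀ hF bF, h.hasDerivAt_primitive_lagY₀ hG bG,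
    h.hasDerivAt_primitive_lagY₀ hH bH] with x ew dF dG dH
  have hd := (dF.add dG).add dH
  rw [← mul_add, ← mul_add, ← ew] at hd
  exact e ▸ hd

/-- The entropies are transported functions of the labels, whatever `F`, `G`, `H` are. -/
theorem entropyCondition (h : IsInitialLabelData s ρ₀ u₀ v₀ a b c K δ) {F G H : ℝ → ℝ}
    (hF : Measurable F) (hG : Measurable G) (hH : Measurable H) (bF : IsLocallyBounded F)
    (bG : IsLocallyBounded G) (bH : IsLocallyBounded H) :
    EntropyCondition s F G H (rhoSol s ρ₀ u₀ v₀) (uSol s ρ₀ u₀ v₀) (vSol s ρ₀ u₀ v₀) := by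
  obtain ⟨L₁, hL₁⟩ := bF.exists_comp_bound h.ba
  obtain ⟨L₂, hL₂⟩ := bG.exists_comp_bound h.bb
  obtain ⟨L₃, hL₃⟩ := bH.exists_comp_bound h.bc
  obtain ⟨m1, m2, hsol⟩ := h.isWeakCauchySolution_of_labels (hF.comp h.ma) (hG.comp h.mb)
    (hH.comp h.mc) hL₁ hL₂ hL₃
    (w := fun t x => entropy s F G H (rhoSol s ρ₀ u₀ v₀ t x) (uSol s ρ₀ u₀ v₀ t x)
      (vSol s ρ₀ u₀ v₀ t x))
    (f := fun t x => entropyFlux s F G H (rhoSol s ρ₀ u₀ v₀ t x) (uSol s ρ₀ u₀ v₀ t x)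
      (vSol s ρ₀ u₀ v₀ t x))
    (by filter_upwards [h.ae_explicit] with p ⟨ea, eb, ec, _, _⟩
        simp only [entropy, Function.comp_apply, ea, eb, ec])
    (by filter_upwards [h.ae_explicit] with p ⟨ea, eb, ec, _, _⟩
        simp only [entropyFlux, Function.comp_apply, ea, eb, ec])
    (Eventually.of_forall fun x => rfl)
  exact hsol.isDistributionalSolution m1 m2

theorem _root_.ConvexOn.measurable_isLocallyBounded {F : ℝ → ℝ} (hF : ConvexOn ℝ univ F) :
    Measurable F ∧ IsLocallyBounded F := by
  have hc : Continuous F := continuousOn_univ.1 (hF.continuousOn isOpen_univ)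
  refine ⟨hc.measurable, fun R => ?_⟩
  obtain ⟨C, hC⟩ := (isCompact_Icc (a := -R) (b := R)).exists_bound_of_continuousOn hc.continuousOn
  exact ⟨C, fun r hr => hC r (abs_le.1 hr)⟩

theorem isEntropySolution (h : IsInitialLabelData s ρ₀ u₀ v₀ a b c K δ) :
    IsEntropySolution s ρ₀ u₀ v₀ (rhoSol s ρ₀ u₀ v₀) (uSol s ρ₀ u₀ v₀) (vSol s ρ₀ u₀ v₀) := by
  have hs := h.s_pos
  obtain ⟨C, hC⟩ := h.exists_lipschitzWith_lagY
  have m0 : Measurable fun _ : ℝ => (0 : ℝ) := measurable_const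
  have b0 : ∀ _ : ℝ, |(0 : ℝ)| ≤ 0 := fun _ => by simp
  obtain ⟨mρ, -, mass⟩ := h.isWeakCauchySolution_of_labels (w₀ := ρ₀)
    (w := rhoSol s ρ₀ u₀ v₀) (f := fun t x => rhoSol s ρ₀ u₀ v₀ t x * uSol s ρ₀ u₀ v₀ t x)
    m0 m0 (measurable_const (a := (1 : ℝ))) b0 b0 (L₃ := 1) (fun _ => by simp)
    (Eventually.of_forall fun p => by simp) (Eventually.of_forall fun p => by simp)
    (Eventually.of_forall fun x => by simp)
  obtain ⟨-, -, momentum⟩ := h.isWeakCauchySolution_of_labels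
    (w₀ := fun x => ρ₀ x * u₀ x)
    (w := fun t x => rhoSol s ρ₀ u₀ v₀ t x * uSol s ρ₀ u₀ v₀ t x)
    (f := fun t x => rhoSol s ρ₀ u₀ v₀ t x * uSol s ρ₀ u₀ v₀ t x ^ 2
      + s ^ 2 * vSol s ρ₀ u₀ v₀ t x)
    (h.ma.const_mul (1 / 2)) (h.mb.const_mul (1 / 2)) m0 (L₁ := |1 / 2| * K) (L₂ := |1 / 2| * K)
    (fun y => by rw [abs_mul]; exact mul_le_mul_of_nonneg_left (h.ba y) (abs_nonneg _))
    (fun y => by rw [abs_mul]; exact mul_le_mul_of_nonneg_left (h.bb y) (abs_nonneg _)) b0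
    (by filter_upwards [h.ae_explicit] with p ⟨ea, eb, _, _, _⟩
        rw [← ea, ← eb]; ring)
    (by filter_upwards [h.ae_explicit] with p ⟨ea, eb, _, _, _⟩
        rw [← ea, ← eb]; ring)
    (by filter_upwards [h.ae_initial] with x ⟨_, ea, eb, _⟩
        rw [ea, eb]; ring)
  obtain ⟨-, -, stress⟩ := h.isWeakCauchySolution_of_labels
    (w₀ := fun x => ρ₀ x * v₀ x)
    (w := fun t x => rhoSol s ρ₀ u₀ v₀ t x * vSol s ρ₀ u₀ v₀ t x)
    (f := fun t x => rhoSol s ρ₀ u₀ v₀ t x * uSol s ρ₀ u₀ v₀ t x * vSol s ρ₀ u₀ v₀ t x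
      + uSol s ρ₀ u₀ v₀ t x)
    (h.ma.const_mul (1 / (2 * s))) (h.mb.const_mul (-(1 / (2 * s)))) m0
    (L₁ := |1 / (2 * s)| * K) (L₂ := |-(1 / (2 * s))| * K)
    (fun y => by rw [abs_mul]; exact mul_le_mul_of_nonneg_left (h.ba y) (abs_nonneg _))
    (fun y => by rw [abs_mul]; exact mul_le_mul_of_nonneg_left (h.bb y) (abs_nonneg _)) b0
    (by filter_upwards [h.ae_explicit] with p ⟨ea, eb, _, _, _⟩
        rw [← ea, ← eb]; field_simp; ring)
    (by filter_upwards [h.ae_explicit] with p ⟨ea, eb, _, _, _⟩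
        rw [← ea, ← eb]; field_simp; ring)
    (by filter_upwards [h.ae_initial] with x ⟨_, ea, eb, _⟩
        rw [ea, eb]; field_simp; ring)
  have cY := hC.continuous.measurable
  have ma' : Measurable fun p : ℝ × ℝ => a (lagY s ρ₀ u₀ v₀ p.1 p.2 + -s * p.1) :=
    h.ma.comp (cY.add (measurable_fst.const_mul _))
  have mb' : Measurable fun p : ℝ × ℝ => b (lagY s ρ₀ u₀ v₀ p.1 p.2 + s * p.1) :=
    h.mb.comp (cY.add (measurable_fst.const_mul _))
  refine
    { rho_memLp := mρ
      u_memLp := ?_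
      v_memLp := ?_
      rho_pos := ae_halfPlane_of_ae (h.ae_explicit.mono fun p hp => hp.2.2.2.1)
      mass := mass
      momentum := momentum
      stress := stress
      entropy_condition := fun F G H hF hG hH => ?_ }
  · refine memLp_top_of_ae_eq (K := |1 / 2| * (K + K)) ((ma'.add mb').const_mul (1 / 2))
      (fun p => ?_) (ae_halfPlane_of_ae ?_)
    · rw [abs_mul]
      exact mul_le_mul_of_nonneg_left ((abs_add_le _ _).trans (add_le_add (h.ba _) (h.bb _)))
        (abs_nonneg _)
    · filter_upwards [h.ae_explicit] with p ⟨ea, eb, _, _, _⟩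
      simp only [Pi.add_apply]
      rw [← ea, ← eb]; ring
  · refine memLp_top_of_ae_eq (K := |1 / (2 * s)| * (K + K))
      ((ma'.sub mb').const_mul (1 / (2 * s))) (fun p => ?_) (ae_halfPlane_of_ae ?_)
    · rw [abs_mul]
      exact mul_le_mul_of_nonneg_left ((abs_sub _ _).trans (add_le_add (h.ba _) (h.bb _)))
        (abs_nonneg _)
    · filter_upwards [h.ae_explicit] with p ⟨ea, eb, _, _, _⟩
      simp only [Pi.sub_apply]
      rw [← ea, ← eb]; field_simp; ring
  · obtain ⟨mF, bF⟩ := hF.measurable_isLocallyBounded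
    obtain ⟨mG, bG⟩ := hG.measurable_isLocallyBounded
    obtain ⟨mH, bH⟩ := hH.measurable_isLocallyBounded
    exact h.entropyCondition mF mG mH bF bG bH

theorem isEulerLagrangeMap (h : IsInitialLabelData s ρ₀ u₀ v₀ a b c K δ) :
    IsEulerLagrangeMap ρ₀ (rhoSol s ρ₀ u₀ v₀) (uSol s ρ₀ u₀ v₀) (lagY s ρ₀ u₀ v₀) := by
  obtain ⟨C, hC⟩ := h.exists_lipschitzWith_lagY
  refine ⟨⟨C, hC.lipschitzOnWith⟩, ae_halfPlane_of_ae ?_, h.lagY_zero⟩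
  filter_upwards [h.ae_explicit] with p ⟨_, _, _, _, hd⟩
  convert hd using 1
  ext <;> simp

/-! ### The linear system in Lagrangian coordinates -/

/-- The explicit solution in Lagrangian coordinates is a superposition of two waves. -/
theorem ae_lagrangian (h : IsInitialLabelData s ρ₀ u₀ v₀ a b c K δ) :
    ∀ᵐ p : ℝ × ℝ,
      uSol s ρ₀ u₀ v₀ p.1 (lagX s ρ₀ u₀ v₀ p.1 p.2)
        = (b (p.2 + s * p.1) + a (p.2 + -s * p.1)) / 2 ∧
      vSol s ρ₀ u₀ v₀ p.1 (lagX s ρ₀ u₀ v₀ p.1 p.2)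
        = (a (p.2 + -s * p.1) - b (p.2 + s * p.1)) / (2 * s) ∧
      1 / rhoSol s ρ₀ u₀ v₀ p.1 (lagX s ρ₀ u₀ v₀ p.1 p.2)
        = c p.2 + (b (p.2 + s * p.1) - a (p.2 + -s * p.1)) / (2 * s) := by
  filter_upwards [ae_comp_shift h.ae_label 0, ae_comp_shift h.ae_label s,
    ae_comp_shift h.ae_label (-s)] with p h0 h1 h2
  simp only [zero_mul, add_zero] at h0
  obtain ⟨eu, ev, er⟩ := h.explicit_eq (h.lagY_lagX p.1 p.2) h0 h1 h2
  exact ⟨eu, ev, by rw [er, one_div_one_div]⟩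

theorem isLagrangianSolution (h : IsInitialLabelData s ρ₀ u₀ v₀ a b c K δ) :
    IsLagrangianSolution s (fun y => 1 / ρ₀ (lagX₀ ρ₀ y)) (fun y => u₀ (lagX₀ ρ₀ y))
      (fun y => v₀ (lagX₀ ρ₀ y))
      (fun t y => 1 / rhoSol s ρ₀ u₀ v₀ t (lagX s ρ₀ u₀ v₀ t y))
      (fun t y => uSol s ρ₀ u₀ v₀ t (lagX s ρ₀ u₀ v₀ t y))
      (fun t y => vSol s ρ₀ u₀ v₀ t (lagX s ρ₀ u₀ v₀ t y)) := by
  have hs := h.s_pos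
  have dA := ae_hasDerivAt_primitive_of_bounded h.ma h.ba
  have dB := ae_hasDerivAt_primitive_of_bounded h.mb h.bb
  have dC := ae_hasDerivAt_primitive_of_bounded h.mc h.bc
  obtain ⟨C, hflow⟩ := h.toIsLabelData.exists_lipschitzWith_flow
  have hwave : ∀ α β : ℝ, ∃ D, LipschitzWith D fun q : ℝ × ℝ =>
      α * primitive b (q.2 + s * q.1) + β * primitive a (q.2 + -s * q.1) := by
    intro α β
    obtain ⟨D₁, h1⟩ := exists_lipschitzWith_add_mul_time LipschitzWith.prod_snd s
    obtain ⟨D₂, h2⟩ := exists_lipschitzWith_add_mul_time LipschitzWith.prod_snd (-s)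
    exact ⟨_, ((lipschitzWith_const_mul α).comp ((lipschitzWith_primitive_of_bounded h.mb h.bb).comp h1)).add
      ((lipschitzWith_const_mul β).comp ((lipschitzWith_primitive_of_bounded h.ma h.ba).comp h2))⟩
  have hwd : ∀ α β : ℝ, ∀ᵐ p : ℝ × ℝ, HasFDerivAt (fun q : ℝ × ℝ =>
      α * primitive b (q.2 + s * q.1) + β * primitive a (q.2 + -s * q.1))
      (covector (s * (α * b (p.2 + s * p.1) - β * a (p.2 + -s * p.1)))
        (α * b (p.2 + s * p.1) + β * a (p.2 + -s * p.1))) p := fun α β => by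
    filter_upwards [ae_comp_shift dB s, ae_comp_shift dA (-s)] with p h1 h2
    exact hasFDerivAt_wave α β h1 h2
  have hw0 : ∀ α β : ℝ, ∀ᵐ y : ℝ, HasDerivAt (fun x =>
      α * primitive b (x + s * 0) + β * primitive a (x + -s * 0)) (α * b y + β * a y) y :=
    fun α β => by
      filter_upwards [dA, dB] with y h1 h2
      simp only [mul_zero, add_zero]
      exact (h2.const_mul α).add (h1.const_mul β)
  -- the potential of the first equation is the flow itself
  have hω : ∀ᵐ p ∂halfPlaneMeasure, HasFDerivAt (flow s a b c)
      (covector (- -uSol s ρ₀ u₀ v₀ p.1 (lagX s ρ₀ u₀ v₀ p.1 p.2))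
        (1 / rhoSol s ρ₀ u₀ v₀ p.1 (lagX s ρ₀ u₀ v₀ p.1 p.2))) p := by
    refine ae_halfPlane_of_ae ?_
    filter_upwards [h.ae_lagrangian, ae_comp_shift dC 0, ae_comp_shift dB s,
      ae_comp_shift dA (-s)] with p ⟨eu, _, er⟩ hc hb ha
    simp only [zero_mul, add_zero] at hc
    rw [eu, er, neg_neg]
    simpa using hasFDerivAt_flow_comp hs.ne' hasFDerivAt_snd_covector hc hb ha
  have hω0 : ∀ᵐ y, HasDerivAt (fun x => flow s a b c (0, x)) (1 / ρ₀ (lagX₀ ρ₀ y)) y := by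
    filter_upwards [dA, dB, dC, h.ae_label] with y h1 h2 h3 ⟨_, ea, eb, ec⟩
    have hd := h3.add ((h2.sub h1).div_const (2 * s))
    have e1 : c y + (b y - a y) / (2 * s) = 1 / ρ₀ (lagX₀ ρ₀ y) := by
      rw [ea, eb, ec]; field_simp; ring
    have e2 : (fun x => flow s a b c (0, x))
        = fun x => primitive c x + (primitive b x - primitive a x) / (2 * s) := by
      funext x; simp [flow]
    rw [e1] at hd
    rw [e2]
    exact hd
  have hν : ∀ᵐ p ∂halfPlaneMeasure, HasFDerivAt (fun q : ℝ × ℝ =>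
      1 / 2 * primitive b (q.2 + s * q.1) + 1 / 2 * primitive a (q.2 + -s * q.1))
      (covector (-(s ^ 2 * vSol s ρ₀ u₀ v₀ p.1 (lagX s ρ₀ u₀ v₀ p.1 p.2)))
        (uSol s ρ₀ u₀ v₀ p.1 (lagX s ρ₀ u₀ v₀ p.1 p.2))) p := by
    refine ae_halfPlane_of_ae ?_
    filter_upwards [h.ae_lagrangian, hwd (1 / 2) (1 / 2)] with p ⟨eu, ev, _⟩ hd
    rw [eu, ev]
    convert hd using 2
    · field_simp
      ring
    · ring
  have hκ : ∀ᵐ p ∂halfPlaneMeasure, HasFDerivAt (fun q : ℝ × ℝ =>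
      -(1 / (2 * s)) * primitive b (q.2 + s * q.1) + 1 / (2 * s) * primitive a (q.2 + -s * q.1))
      (covector (-uSol s ρ₀ u₀ v₀ p.1 (lagX s ρ₀ u₀ v₀ p.1 p.2))
        (vSol s ρ₀ u₀ v₀ p.1 (lagX s ρ₀ u₀ v₀ p.1 p.2))) p := by
    refine ae_halfPlane_of_ae ?_
    filter_upwards [h.ae_lagrangian, hwd (-(1 / (2 * s))) (1 / (2 * s))] with p ⟨eu, ev, _⟩ hd
    rw [eu, ev]
    convert hd using 2
    · field_simp
      ring
    · ring
  obtain ⟨D₁, hD₁⟩ := hwave (1 / 2) (1 / 2)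
  obtain ⟨D₂, hD₂⟩ := hwave (-(1 / (2 * s))) (1 / (2 * s))
  refine
    { omega_memLp := (memLp_of_potential (w := fun t y => 1 / rhoSol s ρ₀ u₀ v₀ t
        (lagX s ρ₀ u₀ v₀ t y)) (f := fun t y => -uSol s ρ₀ u₀ v₀ t (lagX s ρ₀ u₀ v₀ t y))
        hflow hω).1
      nu_memLp := (memLp_of_potential (w := fun t y => uSol s ρ₀ u₀ v₀ t
        (lagX s ρ₀ u₀ v₀ t y)) (f := fun t y => s ^ 2 * vSol s ρ₀ u₀ v₀ t
        (lagX s ρ₀ u₀ v₀ t y)) hD₁ hν).1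
      kappa_memLp := (memLp_of_potential (w := fun t y => vSol s ρ₀ u₀ v₀ t
        (lagX s ρ₀ u₀ v₀ t y)) (f := fun t y => uSol s ρ₀ u₀ v₀ t
        (lagX s ρ₀ u₀ v₀ t y)) hD₂ hκ).1
      omega_eq := isWeakCauchySolution_of_potential hflow hω hω0
      nu_eq := isWeakCauchySolution_of_potential hD₁ hν ?_
      kappa_eq := isWeakCauchySolution_of_potential hD₂ hκ ?_ }
  · filter_upwards [hw0 (1 / 2) (1 / 2), h.ae_label] with y hd ⟨_, ea, eb, _⟩
    convert hd using 1
    rw [ea, eb]; ring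
  · filter_upwards [hw0 (-(1 / (2 * s))) (1 / (2 * s)), h.ae_label] with y hd ⟨_, ea, eb, _⟩
    convert hd using 1
    rw [ea, eb]; field_simp; ring

theorem isDAlembert (h : IsInitialLabelData s ρ₀ u₀ v₀ a b c K δ) :
    IsDAlembert s (fun y => 1 / ρ₀ (lagX₀ ρ₀ y)) (fun y => u₀ (lagX₀ ρ₀ y))
      (fun y => v₀ (lagX₀ ρ₀ y))
      (fun t y => 1 / rhoSol s ρ₀ u₀ v₀ t (lagX s ρ₀ u₀ v₀ t y))
      (fun t y => uSol s ρ₀ u₀ v₀ t (lagX s ρ₀ u₀ v₀ t y))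
      (fun t y => vSol s ρ₀ u₀ v₀ t (lagX s ρ₀ u₀ v₀ t y)) := by
  have hs := h.s_pos
  intro t _
  filter_upwards [h.ae_label] with y ⟨hρ, _⟩
  refine ⟨?_, ?_, ?_⟩
  · simp only [rhoSol, h.lagY_lagX, one_div_div]
    field_simp
    ring
  · simp only [uSol, GammaPlus, UpsilonMinus, atLabel, h.lagY_lagX, ← sub_eq_add_neg]
    ring
  · simp only [vSol, GammaMinus, UpsilonPlus, atLabel, h.lagY_lagX, ← sub_eq_add_neg]
    field_simp

end IsInitialLabelData

/-! ### Uniqueness -/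

theorem spaceDeriv_pos_and_jacobian_of_hasFDerivAt {Y D : ℝ × ℝ → ℝ} {α β d e : ℝ} {p : ℝ × ℝ}
    (hY : HasFDerivAt Y (covector α β) p) (hD : HasFDerivAt D (covector d e) p) (hβ : 0 < β)
    (h : β * d - α * e = 0) :
    0 < spaceDeriv Y p ∧
      spaceDeriv Y p * timeDeriv D p - timeDeriv Y p * spaceDeriv D p = 0 := by
  rw [timeDeriv_of_hasFDerivAt hY, spaceDeriv_of_hasFDerivAt hY, timeDeriv_of_hasFDerivAt hD,
    spaceDeriv_of_hasFDerivAt hD]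
  exact ⟨hβ, h⟩

/-- Transport uniqueness for `t > 0`: a Lipschitz function which vanishes at `t = 0` and is constant
along the level lines of `Y` vanishes. -/
theorem eq_zero_of_initial_of_jacobian {Y D : ℝ × ℝ → ℝ} {K K' : ℝ≥0} (hY : LipschitzWith K Y)
    (hD : LipschitzWith K' D) (hD0 : ∀ x, D (0, x) = 0) {k : ℝ} (hk : 0 < k)
    (hYk : ∀ x, k * |x| ≤ |Y (0, x)|)
    (htr : ∀ᵐ p ∂halfPlaneMeasure, 0 < spaceDeriv Y p ∧
      spaceDeriv Y p * timeDeriv D p - timeDeriv Y p * spaceDeriv D p = 0) {p : ℝ × ℝ}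
    (hp : 0 < p.1) : D p = 0 := by
  rw [← (freezePast_eventuallyEq (P := D) hp).eq_of_nhds]
  refine eq_zero_of_jacobian_eq_zero hY (lipschitzWith_freezePast hD)
    (fun q hq => (freezePast_of_nonpos hq).trans (hD0 _)) hk hYk (ae_halfPlane_iff.2 ?_) p
  filter_upwards [ae_halfPlane_iff.1 htr] with q hq hq0
  have e := (freezePast_eventuallyEq (P := D) hq0).fderiv_eq (𝕜 := ℝ)
  simpa only [timeDeriv, spaceDeriv, e] using hq hq0

/-- The label map of a positive density does not charge null sets: almost every property of labels
holds almost everywhere along each characteristic family. -/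
theorem ae_comp_of_spaceDeriv_pos {Y : ℝ × ℝ → ℝ} {K : ℝ≥0} (hY : LipschitzWith K Y)
    {α β : ℝ → ℝ → ℝ}
    (hd : ∀ᵐ p ∂halfPlaneMeasure, HasFDerivAt Y (covector (α p.1 p.2) (β p.1 p.2)) p)
    (hβ : ∀ᵐ p ∂halfPlaneMeasure, 0 < β p.1 p.2) {q : ℝ → Prop} (hq : ∀ᵐ y, q y) (σ : ℝ) :
    ∀ᵐ p ∂halfPlaneMeasure, q (Y p + σ * p.1) := by
  rw [halfPlaneMeasure_eq_prod] at hd hβ ⊢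
  have hm : Measurable fun p : ℝ × ℝ => Y p + σ * p.1 :=
    hY.continuous.measurable.add (measurable_fst.const_mul σ)
  refine ae_comp_of_ae_slice hm (fun r hr => ?_) hq
  filter_upwards [Measure.ae_ae_of_ae_prod hd, Measure.ae_ae_of_ae_prod hβ] with t h1 h2
  have hl := lipschitzWith_slice_space hY t
  have h3 : ∀ᵐ x, HasDerivAt (fun x => Y (t, x)) (β t x) x := h1.mono fun x hx => hasDerivAt_space hx
  -- the slice is strictly increasing, as the integral of a positive density
  have hmono : StrictMono fun x => Y (t, x) := by
    intro x y hxy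
    have hb : ∀ᵐ x, |β t x| ≤ K := by
      filter_upwards [h3] with x hx
      exact hx.deriv ▸ norm_deriv_le_of_lipschitz hl
    have hβm : AEStronglyMeasurable (β t) volume :=
      (measurable_deriv fun x => Y (t, x)).aestronglyMeasurable.congr (h3.mono fun x hx => hx.deriv)
    have e := hl.sub_eq_intervalIntegral h3 x y
    have hpos : 0 < ∫ ξ in x..y, β t ξ := by
      refine (intervalIntegral.integral_pos_iff_support_of_nonneg_ae (h2.mono fun x hx => hx.le)
        (intervalIntegrable_of_bounded hβm hb x y)).2 ⟨hxy, ?_⟩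
      have hs : (Function.support (β t) ∩ Ioc x y : Set ℝ) =ᵐ[volume] Ioc x y := by
        filter_upwards [h2] with z hz
        exact propext ⟨fun h => h.2, fun h => ⟨hz.ne', h⟩⟩
      rw [measure_congr hs]
      simpa using hxy
    linarith
  refine ae_comp_of_hasDerivAt_ne_zero hl.continuous hmono.injective (g := β t) ?_
    (ae_shift hr (σ * t))
  filter_upwards [h3, h2] with x h4 h5 using ⟨h4, h5.ne'⟩

namespace IsInitialLabelData

variable {s : ℝ} {ρ₀ u₀ v₀ a b c : ℝ → ℝ} {K δ : ℝ} {ρ u v : ℝ → ℝ → ℝ}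

/-- A Riemann invariant `u + σ v`, with `σ = ± s`, of an entropy solution is constant along the
level lines of `Y - σ t`, where `Y` is the potential of the mass equation. Indeed, the combination
`P + σ Q` of the potentials of the other two equations differs from a primitive of the invariant
at time zero, taken at `Y - σ t`, by a function which is constant along these lines. -/
theorem ae_invariant_eq (h : IsInitialLabelData s ρ₀ u₀ v₀ a b c K δ) {Y P Q : ℝ × ℝ → ℝ}
    {K₀ K₁ K₂ : ℝ≥0} (hY : LipschitzWith K₀ Y) (hP : LipschitzWith K₁ P) (hQ : LipschitzWith K₂ Q)
    (hpos : ∀ᵐ p ∂halfPlaneMeasure, 0 < ρ p.1 p.2)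
    (dY : ∀ᵐ p ∂halfPlaneMeasure, HasFDerivAt Y
      (covector (-(ρ p.1 p.2 * u p.1 p.2)) (ρ p.1 p.2)) p)
    (dP : ∀ᵐ p ∂halfPlaneMeasure, HasFDerivAt P
      (covector (-(ρ p.1 p.2 * u p.1 p.2 ^ 2 + s ^ 2 * v p.1 p.2)) (ρ p.1 p.2 * u p.1 p.2)) p)
    (dQ : ∀ᵐ p ∂halfPlaneMeasure, HasFDerivAt Q
      (covector (-(ρ p.1 p.2 * u p.1 p.2 * v p.1 p.2 + u p.1 p.2)) (ρ p.1 p.2 * v p.1 p.2)) p)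
    (hY0 : ∀ x, Y (0, x) = lagY₀ ρ₀ x) {σ : ℝ} (hσ : σ ^ 2 = s ^ 2) {f : ℝ → ℝ} {L : ℝ}
    (hf : Measurable f) (hL : ∀ y, |f y| ≤ L)
    (hPQ : ∀ x, P (0, x) + σ * Q (0, x) = primitive f (lagY₀ ρ₀ x)) :
    ∀ᵐ p ∂halfPlaneMeasure, u p.1 p.2 + σ * v p.1 p.2 = f (Y p + -σ * p.1) := by
  obtain ⟨C, hC⟩ := exists_lipschitzWith_add_mul_time hY (-σ)
  obtain ⟨k, hk, hk'⟩ := h.le_abs_lagY₀_sub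
  have hD := (hP.add ((lipschitzWith_const_mul σ).comp hQ)).sub ((lipschitzWith_primitive_of_bounded hf hL).comp hC)
  have dD : ∀ᵐ p ∂halfPlaneMeasure, HasFDerivAt
      (fun p => P p + σ * Q p - primitive f (Y p + -σ * p.1))
      (covector (-(ρ p.1 p.2 * u p.1 p.2 + σ) * (u p.1 p.2 + σ * v p.1 p.2 - f (Y p + -σ * p.1)))
        (ρ p.1 p.2 * (u p.1 p.2 + σ * v p.1 p.2 - f (Y p + -σ * p.1)))) p := by
    filter_upwards [dY, dP, dQ, ae_comp_of_spaceDeriv_pos hY (α := fun t x => -(ρ t x * u t x))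
      (β := ρ) dY hpos (ae_hasDerivAt_primitive_of_bounded hf hL) (-σ)] with p h0 h1 h2 h3
    have := hasFDerivAt_sub_covector
      (hasFDerivAt_add_covector h1 (hasFDerivAt_const_mul_covector σ h2))
      (HasDerivAt.comp_covector h3 (hasFDerivAt_add_mul_time h0 (-σ)))
    convert this using 2
    · linear_combination (-v p.1 p.2) * hσ
    · ring
  have hzero : ∀ p : ℝ × ℝ, 0 < p.1 → P p + σ * Q p - primitive f (Y p + -σ * p.1) = 0 := by
    intro p hp
    refine eq_zero_of_initial_of_jacobian hC hD (fun x => ?_) hk (fun x => ?_) ?_ hp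
    · simp only [Function.comp_apply, mul_zero, add_zero, hY0, hPQ, sub_self]
    · simpa [hY0, lagY₀_zero] using hk' 0 x
    · filter_upwards [dY, dD, hpos] with p h0 h1 h2
      exact spaceDeriv_pos_and_jacobian_of_hasFDerivAt (hasFDerivAt_add_mul_time h0 (-σ)) h1 h2
        (by ring)
  refine ae_halfPlane_iff.2 ?_
  filter_upwards [ae_halfPlane_iff.1 dD, ae_halfPlane_iff.1 hpos] with p h1 h2 hp
  have e : (fun p => P p + σ * Q p - primitive f (Y p + -σ * p.1)) =ᶠ[𝓝 p] fun _ => 0 := by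
    filter_upwards [continuous_fst.continuousAt.eventually (lt_mem_nhds hp)] with q hq
    exact hzero q hq
  have h3 := spaceDeriv_of_hasFDerivAt (h1 hp)
  rw [spaceDeriv, e.fderiv_eq] at h3
  simp only [fderiv_fun_const, Pi.zero_apply, zero_apply] at h3
  rcases mul_eq_zero.1 h3.symm with h4 | h4
  · exact absurd h4 (h2 hp).ne'
  · exact sub_eq_zero.1 h4

/-- Uniqueness: the potential `Y` of the mass equation carries the Riemann invariants, hence is the
inverse of the flow, which depends on the initial values only. -/
theorem ae_eq_of_isEntropySolution (h : IsInitialLabelData s ρ₀ u₀ v₀ a b c K δ)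
    (hρ₀ : MemLp ρ₀ ⊤ volume) (hu₀ : MemLp u₀ ⊤ volume) (hv₀ : MemLp v₀ ⊤ volume)
    (hsol : IsEntropySolution s ρ₀ u₀ v₀ ρ u v) :
    ∀ᵐ p ∂halfPlaneMeasure, ρ p.1 p.2 = rhoSol s ρ₀ u₀ v₀ p.1 p.2 ∧
      u p.1 p.2 = uSol s ρ₀ u₀ v₀ p.1 p.2 ∧ v p.1 p.2 = vSol s ρ₀ u₀ v₀ p.1 p.2 := by
  have hs := h.s_pos
  have mρ := hsol.rho_memLp
  have mu := hsol.u_memLp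
  have mv := hsol.v_memLp
  have mρu := memLp_top_mul mρ mu
  obtain ⟨Y, K₀, hY, dY, hY0⟩ := hsol.mass.exists_potential mρ mρu hρ₀
  obtain ⟨P, K₁, hP, dP, hP0⟩ := hsol.momentum.exists_potential mρu
    (by simpa only [sq (u _ _), ← mul_assoc] using!
      (memLp_top_mul mρu mu).add (mv.const_mul (s ^ 2)))
    (memLp_top_mul hρ₀ hu₀)
  obtain ⟨Q, K₂, hQ, dQ, hQ0⟩ := hsol.stress.exists_potential (memLp_top_mul mρ mv)
    ((memLp_top_mul mρu mv).add mu) (memLp_top_mul hρ₀ hv₀)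
  have hpos := hsol.rho_pos
  have hY0' : ∀ x, Y (0, x) = lagY₀ ρ₀ x := hY0
  have hPQ : ∀ (σ x : ℝ), P (0, x) + σ * Q (0, x)
      = primitive (fun x => ρ₀ x * u₀ x + σ * (ρ₀ x * v₀ x)) x := by
    intro σ x
    obtain ⟨B₁, -, hB₁⟩ := ae_abs_le_of_memLp_top (memLp_top_mul hρ₀ hu₀)
    obtain ⟨B₂, -, hB₂⟩ := ae_abs_le_of_memLp_top (memLp_top_mul hρ₀ hv₀)
    rw [hP0, hQ0]
    simp only [primitive]
    rw [intervalIntegral.integral_add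
      (intervalIntegrable_of_bounded (memLp_top_mul hρ₀ hu₀).1 hB₁ _ _)
      ((intervalIntegrable_of_bounded (memLp_top_mul hρ₀ hv₀).1 hB₂ _ _).const_mul _),
      intervalIntegral.integral_const_mul]
  have ha := h.ae_invariant_eq hY hP hQ hpos dY dP dQ hY0' (σ := s) rfl h.ma h.ba fun x => by
    rw [hPQ, h.primitive_lagY₀ h.ma h.ba]
    filter_upwards [h.ae_initial] with x ⟨_, ea, _, _⟩
    rw [ea]; ring
  have hb := h.ae_invariant_eq hY hP hQ hpos dY dP dQ hY0' (σ := -s) (neg_sq s) h.mb h.bb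
    fun x => by
      rw [hPQ, h.primitive_lagY₀ h.mb h.bb]
      filter_upwards [h.ae_initial] with x ⟨_, _, eb, _⟩
      rw [eb]; ring
  simp only [neg_neg] at hb
  obtain ⟨C, hC⟩ := h.exists_lipschitzWith_flow
  obtain ⟨k, hk, hk'⟩ := h.le_abs_lagY₀_sub
  have hcomp := fun {q : ℝ → Prop} (hq : ∀ᵐ y, q y) σ => ae_comp_of_spaceDeriv_pos hY
    (α := fun t x => -(ρ t x * u t x)) (β := ρ) dY hpos hq σ
  -- the flow map inverts the potential of the mass equation
  have hflow : ∀ p : ℝ × ℝ, 0 < p.1 → flow s a b c (p.1, Y p) - p.2 = 0 := by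
    intro p hp
    refine eq_zero_of_initial_of_jacobian (D := fun p => flow s a b c (p.1, Y p) - p.2) hY
      ((hC.comp (LipschitzWith.prod_fst.prodMk hY)).sub LipschitzWith.prod_snd)
      (fun x => ?_) hk (fun x => ?_) ?_ hp
    · simp only [hY0', h.flow_lagY₀, sub_self]
    · simpa [hY0', lagY₀_zero] using hk' 0 x
    · filter_upwards [dY, hpos, ha, hb, hcomp (ae_hasDerivAt_primitive_of_bounded h.mc h.bc) 0,
        hcomp (ae_hasDerivAt_primitive_of_bounded h.mb h.bb) s,
        hcomp (ae_hasDerivAt_primitive_of_bounded h.ma h.ba) (-s)] with p h0 h1 ea eb h2 h3 h4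
      simp only [zero_mul, add_zero] at h2
      refine spaceDeriv_pos_and_jacobian_of_hasFDerivAt h0
        (hasFDerivAt_sub_covector (hasFDerivAt_flow_comp hs.ne' h0 h2 h3 h4)
          hasFDerivAt_snd_covector) h1 ?_
      rw [← ea, ← eb]
      ring
  have hYlag : ∀ p : ℝ × ℝ, 0 < p.1 → Y p = lagY s ρ₀ u₀ v₀ p.1 p.2 := fun p hp =>
    (h.bijective_flow p.1).injective ((sub_eq_zero.1 (hflow p hp)).trans (h.flow_lagY p).symm)
  refine ae_halfPlane_iff.2 ?_
  filter_upwards [h.ae_explicit, ae_halfPlane_iff.1 dY, ae_halfPlane_iff.1 ha,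
    ae_halfPlane_iff.1 hb] with p ⟨ea', eb', _, _, hd'⟩ hd ea eb hp
  have e1 := ea hp
  have e2 := eb hp
  rw [hYlag p hp, ← ea'] at e1
  rw [hYlag p hp, ← eb'] at e2
  have e : Y =ᶠ[𝓝 p] fun q => lagY s ρ₀ u₀ v₀ q.1 q.2 := by
    filter_upwards [continuous_fst.continuousAt.eventually (lt_mem_nhds hp)] with q hq
    exact hYlag q hq
  refine ⟨?_, by linarith, ?_⟩
  · rw [← spaceDeriv_of_hasFDerivAt (hd hp), spaceDeriv, e.fderiv_eq]
    exact spaceDeriv_of_hasFDerivAt hd'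
  · refine mul_left_cancel₀ hs.ne' ?_
    linarith

end IsInitialLabelData

end BouchutBoyaval

end

theorem mainTheorem1 (s : ℝ) (hs : 0 < s) (ρ₀ u₀ v₀ : ℝ → ℝ)
    (hρ₀ : MemLp ρ₀ ⊤ volume) (hu₀ : MemLp u₀ ⊤ volume) (hv₀ : MemLp v₀ ⊤ volume)
    (ρmin : ℝ) (hρmin : 0 < ρmin) (hρ₀_lower : ∀ᵐ x, ρmin ≤ ρ₀ x)
    (hH1 : BouchutBoyaval.HypH1 s ρ₀ u₀ v₀) (hH2 : BouchutBoyaval.HypH2 s u₀ v₀)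
    (hspeed : essInf (fun x => u₀ x + s / ρ₀ x) volume
      > essSup (fun x => u₀ x - s / ρ₀ x) volume) :
    -- the changes of variables are well defined
    Function.Bijective (BouchutBoyaval.lagY₀ ρ₀) ∧
    (∀ t : ℝ, 0 ≤ t → Function.Bijective (BouchutBoyaval.lagX s ρ₀ u₀ v₀ t)) ∧
    -- the explicit triple is a global bounded entropy solution
    BouchutBoyaval.IsEntropySolution s ρ₀ u₀ v₀ (BouchutBoyaval.rhoSol s ρ₀ u₀ v₀)
      (BouchutBoyaval.uSol s ρ₀ u₀ v₀) (BouchutBoyaval.vSol s ρ₀ u₀ v₀) ∧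
    -- it satisfies the entropy condition also without convexity
    (∀ F G H : ℝ → ℝ, Measurable F → Measurable G → Measurable H →
      BouchutBoyaval.IsLocallyBounded F → BouchutBoyaval.IsLocallyBounded G →
      BouchutBoyaval.IsLocallyBounded H →
      BouchutBoyaval.EntropyCondition s F G H (BouchutBoyaval.rhoSol s ρ₀ u₀ v₀)
        (BouchutBoyaval.uSol s ρ₀ u₀ v₀) (BouchutBoyaval.vSol s ρ₀ u₀ v₀)) ∧
    -- it is the only entropy solution
    (∀ ρ u v : ℝ → ℝ → ℝ, BouchutBoyaval.IsEntropySolution s ρ₀ u₀ v₀ ρ u v →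
      ∀ᵐ p ∂BouchutBoyaval.halfPlaneMeasure,
        ρ p.1 p.2 = BouchutBoyaval.rhoSol s ρ₀ u₀ v₀ p.1 p.2 ∧
        u p.1 p.2 = BouchutBoyaval.uSol s ρ₀ u₀ v₀ p.1 p.2 ∧
        v p.1 p.2 = BouchutBoyaval.vSol s ρ₀ u₀ v₀ p.1 p.2) ∧
    -- `Y` is its Euler--Lagrange map
    BouchutBoyaval.IsEulerLagrangeMap ρ₀ (BouchutBoyaval.rhoSol s ρ₀ u₀ v₀)
      (BouchutBoyaval.uSol s ρ₀ u₀ v₀) (BouchutBoyaval.lagY s ρ₀ u₀ v₀) ∧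
    -- in Lagrangian coordinates it solves the linear system, by the d'Alembert-type formulas
    BouchutBoyaval.IsLagrangianSolution s
      (fun y => 1 / ρ₀ (BouchutBoyaval.lagX₀ ρ₀ y)) (fun y => u₀ (BouchutBoyaval.lagX₀ ρ₀ y))
      (fun y => v₀ (BouchutBoyaval.lagX₀ ρ₀ y))
      (fun t y => 1 / BouchutBoyaval.rhoSol s ρ₀ u₀ v₀ t (BouchutBoyaval.lagX s ρ₀ u₀ v₀ t y))
      (fun t y => BouchutBoyaval.uSol s ρ₀ u₀ v₀ t (BouchutBoyaval.lagX s ρ₀ u₀ v₀ t y))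
      (fun t y => BouchutBoyaval.vSol s ρ₀ u₀ v₀ t (BouchutBoyaval.lagX s ρ₀ u₀ v₀ t y)) ∧
    BouchutBoyaval.IsDAlembert s
      (fun y => 1 / ρ₀ (BouchutBoyaval.lagX₀ ρ₀ y)) (fun y => u₀ (BouchutBoyaval.lagX₀ ρ₀ y))
      (fun y => v₀ (BouchutBoyaval.lagX₀ ρ₀ y))
      (fun t y => 1 / BouchutBoyaval.rhoSol s ρ₀ u₀ v₀ t (BouchutBoyaval.lagX s ρ₀ u₀ v₀ t y))
      (fun t y => BouchutBoyaval.uSol s ρ₀ u₀ v₀ t (BouchutBoyaval.lagX s ρ₀ u₀ v₀ t y))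
      (fun t y => BouchutBoyaval.vSol s ρ₀ u₀ v₀ t (BouchutBoyaval.lagX s ρ₀ u₀ v₀ t y)) := by
  obtain ⟨a, b, c, K, δ, h⟩ := BouchutBoyaval.exists_initialLabelData hs hρ₀ hu₀ hv₀ hρmin
    hρ₀_lower hH1
  exact ⟨h.bijective_lagY₀, fun t _ => h.bijective_lagX t, h.isEntropySolution,
    fun _ _ _ hF hG hH bF bG bH => h.entropyCondition hF hG hH bF bG bH,
    fun _ _ _ hsol => h.ae_eq_of_isEntropySolution hρ₀ hu₀ hv₀ hsol,
    h.isEulerLagrangeMap, h.isLagrangianSolution, h.isDAlembert⟩
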